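/- **Notation.** Let $\mathbb H=\{z=x+iy\in\mathbb C: y>0\}$, $q^n=e^{2\pi i n z}$, and $$\Delta_k=-y^2\Big(\frac{\partial^2}{\partial x^2}+\frac{\partial^2}{\partial y^2}\Big)+iky\Big(\frac{\partial}{\partial x}+i\frac{\partial}{\partial y}\Big),\qquad \xi_kF= i y^k\,\overline{\Big(\frac{\partial F}{\partial x}+i\frac{\partial F}{\partial y}\Big)} .$$ For $\gamma=\begin{pmatrix}a&b\\c&d\end{pmatrix}\in \mathrm{SL}_2(\mathbb Z)$ let $(F|_{1/2}\gamma)(z)=(cz+d)^{-1/2}F\big(\frac{az+b}{cz+d}\big)$ (principal branch), and for $4\mid c$ let $\nu_\theta(\gamma)=\varepsilon_d^{-1}\left(\frac cd\right)$ be the multiplier of $\theta(z)=\sum_{n\in\mathbb Z}q^{n^2}$, where $\left(\frac cd\right)$ is the Kronecker symbol and $\varepsilon_d=1$ if $d\equiv1\pmod 4$, $\varepsilon_d=i$ if $d\equiv 3\pmod 4$. For an integer $N\ge1$, let $M_{1/2}(4N)$ be the space of holomorphic $f:\mathbb H\to\mathbb C$ with $f|_{1/2}\gamma=\nu_\theta(\gamma)f$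 for all $\gamma\in\Gamma_0(4N)$ that are holomorphic at all cusps (that is, $f|_{1/2}\gamma$ is bounded as $y\to\infty$ for every $\gamma\in\mathrm{SL}_2(\mathbb Z)$). Let $V_{1/2}(4N)$ be the space of real-analytic $F:\mathbb H\to\mathbb C$ such that 1. $F|_{1/2}\gamma=\nu_\theta(\gamma)F$ for all $\gamma\in\Gamma_0(4N)$; 2. $\xi_{1/2}(\Delta_{1/2}F)=0$; 3. $F$ has at most linear exponential growth at the cusps: for every $\gamma\in\mathrm{SL}_2(\mathbb Z)$ there is a constant $C$ with $(F|_{1/2}\gamma)(z)=O(e^{Cy})$ as $y\to\infty$, uniformly in $x$; 4. $\Delta_{1/2}F\in M_{1/2}(4N)$. Finally put $$\alpha(y)=\frac{\sqrt y}{4\pi}\int_0^\infty t^{-1/2}e^{-\pi yt}\log(1+t)\,dt\quad(y>0),\qquad \beta(y)=\frac1{\sqrt\pi}\,\Gamma\!\left(\tfrac12,\pi y\right)=\frac1{\sqrt\pi}\int_{\pi y}^\infty t^{-1/2}e^{-t}\,dt\quad(y\in\mathbb R),$$ the latter integral along the real line, with the principal branch $t^{-1/2}=-i|t|^{-1/2}$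 for $t<0$. **Proposition.** Let $N\ge 1$ and $F\in V_{1/2}(4N)$. Then there are complex numbers $d(0),d(1),d(2),d(3)$, $c(n)$ and $b(n)$ ($n\in\mathbb Z\setminus\{0\}$), and $a(n)$ ($n\ge1$), with $c(n)=0$ for all sufficiently negative $n$ and $b(n)=0$ for all sufficiently large $n$, such that for all $z=x+iy\in\mathbb H$ $$F(z)=\Big(d(0)+d(1)\log y+d(2)y^{1/2}+d(3)y^{1/2}\log y\Big)+\sum_{\substack{n\gg-\infty\\ n\ne0}}c(n)q^n+\sum_{\substack{n\ll\infty\\ n\neq0}}b(n)\beta(-4ny)q^n+\sum_{n\ge1}a(n)\alpha(4ny)q^n,$$ where each of the three series converges absolutely. -/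

import Mathlib

open scoped MatrixGroups

noncomputable section

namespace Sesqui

open UpperHalfPlane

/-! ### Differential operators on functions on the upper half plane

Here `F ∘ ofComplex` is `F`, viewed as a function on an open subset of `ℂ = ℝ²`. -/

/-- `F` is real-analytic on the upper half plane. -/
def RealAnalytic (F : ℍ → ℂ) : Prop :=
  AnalyticOnNhd ℝ (F ∘ ofComplex) {z : ℂ | 0 < z.im}

/-- `F` is holomorphic on the upper half plane. -/
def Holomorphic (F : ℍ → ℂ) : Prop :=
  DifferentiableOn ℂ (F ∘ ofComplex) {z : ℂ | 0 < z.im}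

/-- The partial derivative `∂F/∂x`, where `z = x + iy`. -/
def dx (F : ℍ → ℂ) (z : ℍ) : ℂ := fderiv ℝ (F ∘ ofComplex) (z : ℂ) 1

/-- The partial derivative `∂F/∂y`, where `z = x + iy`. -/
def dy (F : ℍ → ℂ) (z : ℍ) : ℂ := fderiv ℝ (F ∘ ofComplex) (z : ℂ) Complex.I

/-- The Bruinier–Funke operator `ξ_k F = i y^k conj (∂F/∂x + i ∂F/∂y)`. -/
def xi (k : ℝ) (F : ℍ → ℂ) (z : ℍ) : ℂ :=
  Complex.I * ((z.im ^ k : ℝ) : ℂ) * (starRingEnd ℂ) (dx F z + Complex.I * dy F z)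

/-- The weight `k` hyperbolic Laplacian
`Δ_k F = -y² (∂²F/∂x² + ∂²F/∂y²) + i k y (∂F/∂x + i ∂F/∂y)`. -/
def laplacian (k : ℝ) (F : ℍ → ℂ) (z : ℍ) : ℂ :=
  -(z.im : ℂ) ^ 2 * (dx (dx F) z + dy (dy F) z)
    + Complex.I * (k : ℂ) * (z.im : ℂ) * (dx F z + Complex.I * dy F z)

/-! ### The slash operator and the theta multiplier -/

/-- `(F|_k γ)(z) = (cz+d)^(-k) F(γ z)`, with the principal branch of the power. -/
def slash (k : ℝ) (F : ℍ → ℂ) (γ : SL(2, ℤ)) (z : ℍ) : ℂ :=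
  (((γ 1 0 : ℤ) : ℂ) * (z : ℂ) + ((γ 1 1 : ℤ) : ℂ)) ^ (-(k : ℂ)) * F (γ • z)

/-- The Kronecker symbol `(c/d)` for odd `d`: the Jacobi symbol `(c/|d|)`, times, when
`d < 0`, the Kronecker symbol of `c` over `-1`, which is `-1` for `c < 0` and `1` for `c ≥ 0`. -/
def kroneckerOdd (c d : ℤ) : ℤ :=
  jacobiSym c d.natAbs * (if c < 0 ∧ d < 0 then -1 else 1)

/-- For odd `d`: `ε_d = 1` if `d ≡ 1 (mod 4)` and `ε_d = i` if `d ≡ 3 (mod 4)`. -/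
def epsilon (d : ℤ) : ℂ := if d % 4 = 1 then 1 else Complex.I

/-- The multiplier `ε_d⁻¹ (c/d)` of the theta function `∑ q^(n²)`, for `γ ∈ Γ₀(4)`. -/
def thetaMultiplier (γ : SL(2, ℤ)) : ℂ :=
  (epsilon (γ 1 1))⁻¹ * (kroneckerOdd (γ 1 0) (γ 1 1) : ℂ)

/-- `F|_{1/2} γ = ν_θ(γ) F` for all `γ ∈ Γ₀(4N)`. -/
def TransformsHalf (N : ℕ) (F : ℍ → ℂ) : Prop :=
  ∀ γ ∈ CongruenceSubgroup.Gamma0 (4 * N), ∀ z : ℍ,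
    slash (1 / 2) F γ z = thetaMultiplier γ * F z

/-! ### Spaces of forms of weight `1/2` -/

/-- `M_{1/2}(4N)`: the holomorphic modular forms of weight `1/2` on `Γ₀(4N)`.
Holomorphy at the cusp `γ ∞` is boundedness of `f|γ` as `Im z → ∞`. -/
def modularFormsHalf (N : ℕ) : Set (ℍ → ℂ) :=
  {f | Holomorphic f ∧ TransformsHalf N f ∧
    ∀ γ : SL(2, ℤ), IsBoundedAtImInfty (slash (1 / 2) f γ)}

/-- At most linear exponential growth at every cusp `γ ∞`: `F|_{1/2} γ = O(e^(C y))` as `y → ∞`,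
uniformly in `x`, for some constant `C`. -/
def LinearExponentialGrowthAtCusps (F : ℍ → ℂ) : Prop :=
  ∀ γ : SL(2, ℤ), ∃ C : ℝ,
    slash (1 / 2) F γ =O[atImInfty] fun z : ℍ => Real.exp (C * z.im)

/-- Sesquiharmonic Maass forms of weight `1/2` on `Γ₀(4N)`. -/
structure IsSesquiharmonicMaassFormHalf (N : ℕ) (F : ℍ → ℂ) : Prop where
  realAnalytic : RealAnalytic F
  transforms : TransformsHalf N F
  xi_laplacian : ∀ z : ℍ, xi (1 / 2) (laplacian (1 / 2) F) z = 0
  growth : LinearExponentialGrowthAtCusps F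

/-- `V_{1/2}(4N)`: the sesquiharmonic Maass forms `F` of weight `1/2` on `Γ₀(4N)` for which
`Δ_{1/2} F` lies in `M_{1/2}(4N)`. -/
def sesquiharmonicSpaceHalf (N : ℕ) : Set (ℍ → ℂ) :=
  {F | IsSesquiharmonicMaassFormHalf N F ∧ laplacian (1 / 2) F ∈ modularFormsHalf N}

/-! ### Special functions -/

/-- `α(y) = (√y / 4π) ∫_0^∞ t^(-1/2) e^(-π y t) log (1 + t) dt`, for `y > 0`. -/
def alpha (y : ℝ) : ℝ :=
  Real.sqrt y / (4 * Real.pi) *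
    ∫ t in Set.Ioi (0 : ℝ), t ^ (-(1 / 2) : ℝ) * Real.exp (-Real.pi * y * t) * Real.log (1 + t)

/-- `β(y) = π^(-1/2) Γ(1/2, π y) = π^(-1/2) ∫_{π y}^∞ t^(-1/2) e^(-t) dt`, for all real `y`, with
the principal branch `t^(-1/2) = -i |t|^(-1/2)` for `t < 0`. -/
def beta (y : ℝ) : ℂ :=
  ((1 / Real.sqrt Real.pi : ℝ) : ℂ) *
    ∫ t in Set.Ioi (Real.pi * y), (t : ℂ) ^ (-(1 / 2) : ℂ) * Complex.exp (-(t : ℂ))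

/-- `q^n = e^(2π i n z)`. -/
def qpow (n : ℤ) (z : ℍ) : ℂ := Complex.exp (2 * Real.pi * Complex.I * n * (z : ℂ))

end Sesqui

end

noncomputable section

namespace Sesqui

open UpperHalfPlane MeasureTheory Set Filter Topology

/-! ### Laplace transforms and the function `alpha` -/

/-! Invariance under `z ↦ z + 1` reduces the claim to one ordinary differential equation per Fourier
index. Put `f = Δ F`. The equation `ξ f = 0` is Cauchy-Riemann for `f`, so its coefficients are
`A(n) e^{-2πny}`, and boundedness at infinity forces `A(n) = 0` for `n < 0`. If `g` is the `n`-th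
coefficient of `F`, then `w = g e^{2πny}` satisfies `w'' = (4πn - 1/(2y)) w' - A(n)/y²`
(`exists_coeff_eq`).

The homogeneous solutions are spanned by `1` and `β(-4ny)`, or by `1` and `√y` when `n = 0`. A
particular solution is `-8πA(n) α(4ny)` for `n > 0` and `2A(0) log y` for `n = 0`. That `α` fits
rests on a relation between moments of its Laplace weight (`logMoment_relation`). As `y → ∞`, the
growth condition excludes `c(n)` for very negative `n`, because `β → 0` at `+∞`, and `b(n)` for very
positive `n`, because `β(-s)` grows like `e^{πs}` up to powers of `s` (`eq_zero_of_beta_neg_le`).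

Convergence at height `y` follows from the height `y/2`: there the Fourier coefficients are bounded
uniformly in `n`, and moving up to `y` gains a factor `e^{-πy|n|}`. Absolute convergence in turn
lets the Fourier series represent `F` pointwise. -/

/-- A Laplace transform may be differentiated under the integral sign. -/
lemma hasDerivAt_laplace {φ : ℝ → ℝ}
    (hφ : ∀ s > 0, IntegrableOn (fun t => φ t * Real.exp (-(s * t))) (Ioi 0)) {s : ℝ} (hs : 0 < s) :
    IntegrableOn (fun t => t * φ t * Real.exp (-(s * t))) (Ioi 0) ∧
    HasDerivAt (fun s => ∫ t in Ioi (0 : ℝ), φ t * Real.exp (-(s * t)))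
      (-∫ t in Ioi (0 : ℝ), t * φ t * Real.exp (-(s * t))) s := by
  have hmeas : AEStronglyMeasurable (fun t => t * φ t * Real.exp (-(s * t)))
      (volume.restrict (Ioi 0)) := by
    have := (hφ s hs).aestronglyMeasurable
    have h2 : AEStronglyMeasurable (fun t : ℝ => t) (volume.restrict (Ioi 0)) := by fun_prop
    refine (h2.mul this).congr (Eventually.of_forall fun t => ?_)
    simp only [Pi.mul_apply]; ring
  have key := hasDerivAt_integral_of_dominated_loc_of_deriv_le
    (μ := volume.restrict (Ioi (0 : ℝ))) (x₀ := s)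
    (F := fun s t => φ t * Real.exp (-(s * t)))
    (F' := fun s t => -(t * φ t * Real.exp (-(s * t))))
    -- For `r > s/2` the factor `e^{-rt}` is at most `e^{-st/2}`. Half of this decay absorbs `t ≤
    -- (4/s) e^{st/4}`; the other half is the hypothesis at `s/4`.
    (bound := fun t => (4 / s) * ‖φ t * Real.exp (-(s / 4 * t))‖) (s := Ioi (s / 2))
    (Ioi_mem_nhds (by linarith))
    (by
      filter_upwards [Ioi_mem_nhds hs] with r hr
      exact (hφ r hr).aestronglyMeasurable)
    (hφ s hs) hmeas.neg
    (by
      filter_upwards [ae_restrict_mem measurableSet_Ioi] with t ht r hr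
      simp only [mem_Ioi] at ht hr
      have h1 : t ≤ 4 / s * Real.exp (s / 4 * t) := by
        have := Real.add_one_le_exp (s / 4 * t)
        calc t = 4 / s * (s / 4 * t) := by field_simp
          _ ≤ _ := by gcongr; linarith
      have h2 : Real.exp (-(r * t)) ≤ Real.exp (-(s / 2 * t)) := by
        apply Real.exp_le_exp.2; nlinarith
      rw [norm_neg, norm_mul, norm_mul, norm_mul, Real.norm_of_nonneg ht.le,
        Real.norm_of_nonneg (Real.exp_pos _).le, Real.norm_of_nonneg (Real.exp_pos _).le]
      calc t * ‖φ t‖ * Real.exp (-(r * t))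
          ≤ (4 / s * Real.exp (s / 4 * t)) * ‖φ t‖ * Real.exp (-(s / 2 * t)) := by gcongr
        _ = 4 / s * (‖φ t‖ * (Real.exp (s / 4 * t) * Real.exp (-(s / 2 * t)))) := by ring
        _ = _ := by rw [← Real.exp_add]; congr 4; ring)
    ((hφ (s / 4) (by linarith)).norm.const_mul _)
    (by
      filter_upwards with t r _
      have : HasDerivAt (fun r : ℝ => -(r * t)) (-t) r := by
        simpa using ((hasDerivAt_id r).mul_const t).fun_neg
      refine (this.exp.const_mul (φ t)).congr_deriv ?_
      ring)
  refine ⟨?_, ?_⟩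
  · exact key.1.neg.congr (Eventually.of_forall fun t => neg_neg _)
  · rw [← integral_neg]; exact key.2

/-- The weight whose Laplace transform gives `alpha`. -/
def logWeight (t : ℝ) : ℝ := t ^ (-(1 / 2) : ℝ) * Real.log (1 + t)

lemma logWeight_nonneg {t : ℝ} (ht : 0 < t) : 0 ≤ logWeight t :=
  mul_nonneg (by positivity) (Real.log_nonneg (by linarith))

/-- Follows from `log (1 + t) ≤ t`; the exponent is kept as `3/2 - 1` to match the Gamma integral.
-/
lemma logWeight_le {t : ℝ} (ht : 0 < t) : logWeight t ≤ t ^ ((3 / 2 : ℝ) - 1) := by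
  have h : Real.log (1 + t) ≤ t := by
    have := Real.log_le_sub_one_of_pos (show 0 < 1 + t by linarith); linarith
  calc logWeight t ≤ t ^ (-(1 / 2) : ℝ) * t := by unfold logWeight; gcongr
    _ = t ^ ((3 / 2 : ℝ) - 1) := by
      nth_rw 2 [← Real.rpow_one t]; rw [← Real.rpow_add ht]; norm_num

lemma integrableOn_sqrt_mul_exp {s : ℝ} (hs : 0 < s) :
    IntegrableOn (fun t : ℝ => t ^ ((3 / 2 : ℝ) - 1) * Real.exp (-(s * t))) (Ioi 0) := by
  have := integrableOn_rpow_mul_exp_neg_mul_rpow (p := 1) (s := (3 / 2 : ℝ) - 1)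
    (by norm_num) one_pos hs
  simpa using this

lemma integrableOn_logWeight {s : ℝ} (hs : 0 < s) :
    IntegrableOn (fun t => logWeight t * Real.exp (-(s * t))) (Ioi 0) := by
  refine (integrableOn_sqrt_mul_exp hs).mono' ?_ ?_
  · unfold logWeight; exact Measurable.aestronglyMeasurable (by fun_prop)
  · filter_upwards [ae_restrict_mem measurableSet_Ioi] with t ht
    rw [Real.norm_of_nonneg (mul_nonneg (logWeight_nonneg ht) (Real.exp_pos _).le)]
    have := logWeight_le ht
    gcongr

/-- The `j`-th moment of `logWeight t * exp (-s t)`. -/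
def logMoment (j : ℕ) (s : ℝ) : ℝ :=
  ∫ t in Ioi (0 : ℝ), t ^ j * logWeight t * Real.exp (-(s * t))

lemma integrableOn_logMoment (j : ℕ) : ∀ s > 0,
    IntegrableOn (fun t => t ^ j * logWeight t * Real.exp (-(s * t))) (Ioi 0) := by
  induction j with
  | zero => intro s hs; simpa using integrableOn_logWeight hs
  | succ j ih =>
    intro s hs
    refine (hasDerivAt_laplace ih hs).1.congr_fun (fun t _ => ?_) measurableSet_Ioi
    simp only; ring

lemma hasDerivAt_logMoment (j : ℕ) {s : ℝ} (hs : 0 < s) :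
    HasDerivAt (logMoment j) (-logMoment (j + 1) s) s := by
  refine (hasDerivAt_laplace (integrableOn_logMoment j) hs).2.congr_deriv ?_
  unfold logMoment
  congr 2; ext t; ring

lemma integral_sqrt_mul_exp {s : ℝ} (hs : 0 < s) :
    ∫ t in Ioi (0 : ℝ), t ^ ((3 / 2 : ℝ) - 1) * Real.exp (-(s * t))
      = Real.sqrt Real.pi / (2 * (s * Real.sqrt s)) := by
  rw [Real.integral_rpow_mul_exp_neg_mul_Ioi (by norm_num) hs,
    show (3 / 2 : ℝ) = 1 / 2 + 1 by norm_num, Real.Gamma_add_one (by norm_num),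
    Real.Gamma_one_half_eq, Real.rpow_add (by positivity), Real.rpow_one, ← Real.sqrt_eq_rpow,
    Real.sqrt_div zero_le_one, Real.sqrt_one]
  field_simp

/-- Integration by parts gives a linear relation between the moments. -/
lemma logMoment_relation {s : ℝ} (hs : 0 < s) :
    logMoment 0 s / 2 + (3 / 2 - s) * logMoment 1 s - s * logMoment 2 s
      + Real.sqrt Real.pi / (2 * (s * Real.sqrt s)) = 0 := by
  -- The factor `1 + t` cancels the denominator from differentiating the logarithm, so `f'` involves
  -- only the moment integrands and `√t e^{-st}`. Since `f` vanishes at `0` and at infinity, `f'`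
  -- has integral zero.
  set f : ℝ → ℝ := fun t => Real.sqrt t * (1 + t) * Real.log (1 + t) * Real.exp (-(s * t))
  set f' : ℝ → ℝ := fun t => (1 / 2) * (t ^ 0 * logWeight t * Real.exp (-(s * t)))
    + (3 / 2 - s) * (t ^ 1 * logWeight t * Real.exp (-(s * t)))
    - s * (t ^ 2 * logWeight t * Real.exp (-(s * t)))
    + t ^ ((3 / 2 : ℝ) - 1) * Real.exp (-(s * t))
  have i0 := (integrableOn_logMoment 0 s hs).const_mul (1 / 2)
  have i1 := (integrableOn_logMoment 1 s hs).const_mul (3 / 2 - s)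
  have i2 := (integrableOn_logMoment 2 s hs).const_mul s
  have i3 := integrableOn_sqrt_mul_exp hs
  have hw : ∀ t > 0, logWeight t = Real.log (1 + t) / Real.sqrt t := by
    intro t ht
    rw [logWeight, Real.rpow_neg ht.le, ← Real.sqrt_eq_rpow]; ring
  have hf' : IntegrableOn f' (Ioi 0) := ((i0.add i1).sub i2).add i3
  have hf : IntegrableOn f (Ioi 0) := by
    refine ((integrableOn_logMoment 1 s hs).add (integrableOn_logMoment 2 s hs)).congr_fun
      (fun t ht => ?_) measurableSet_Ioi
    have h0 : 0 < Real.sqrt t := Real.sqrt_pos.2 ht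
    have h1 : Real.sqrt t ^ 2 = t := Real.sq_sqrt (le_of_lt ht)
    simp only [Pi.add_apply, hw t ht, f]
    field_simp
    rw [h1]; ring
  have hd : ∀ t ∈ Ioi (0 : ℝ), HasDerivAt f (f' t) t := by
    intro t ht
    have ht' : 0 < t := ht
    have h0 : 0 < Real.sqrt t := Real.sqrt_pos.2 ht
    have h1 : Real.sqrt t ^ 2 = t := Real.sq_sqrt (le_of_lt ht)
    have hl : HasDerivAt (fun t : ℝ => 1 + t) 1 t := by simpa using (hasDerivAt_id t).const_add 1
    have he : HasDerivAt (fun t : ℝ => -(s * t)) (-s) t := by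
      simpa using ((hasDerivAt_id t).const_mul s).fun_neg
    have := (((Real.hasDerivAt_sqrt ht'.ne').fun_mul hl).fun_mul (hl.log (by linarith))).fun_mul he.exp
    refine this.congr_deriv ?_
    simp only [f', hw t ht]
    rw [show (3 / 2 : ℝ) - 1 = 1 / 2 by norm_num, ← Real.sqrt_eq_rpow]
    have h2 : 1 + t ≠ 0 := by linarith
    have h3 : Real.sqrt t * Real.sqrt t = t := Real.mul_self_sqrt ht'.le
    field_simp
    simp only [h1]; ring
  have hlim := tendsto_zero_of_hasDerivAt_of_integrableOn_Ioi hd hf' hf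
  have hc : ContinuousWithinAt f (Ici 0) 0 := by
    apply ContinuousAt.continuousWithinAt
    simp only [f]
    have : ContinuousAt (fun t : ℝ => Real.log (1 + t)) 0 := by
      apply ContinuousAt.log (by fun_prop); norm_num
    fun_prop
  have hI := integral_Ioi_of_hasDerivAt_of_tendsto hc hd hf' hlim
  have : f 0 = 0 := by simp [f]
  rw [this, sub_zero] at hI
  have e : ∫ t in Ioi (0 : ℝ), f' t = (1 / 2) * logMoment 0 s + (3 / 2 - s) * logMoment 1 s
      - s * logMoment 2 s + Real.sqrt Real.pi / (2 * (s * Real.sqrt s)) := by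
    rw [← integral_sqrt_mul_exp hs]
    simp only [logMoment]
    refine (integral_add ((i0.add i1).sub i2) i3).trans ?_
    rw [integral_sub' (i0.add i1) i2, integral_add' i0 i1, integral_const_mul, integral_const_mul, integral_const_mul]
  linarith

lemma alpha_eq (y : ℝ) : alpha y = Real.sqrt y / (4 * Real.pi) * logMoment 0 (Real.pi * y) := by
  unfold alpha logMoment logWeight
  congr 2; ext t
  rw [pow_zero, one_mul, show -Real.pi * y * t = -(Real.pi * y * t) by ring]; ring

/-- The first derivative of `alpha`. -/
def alphaDeriv (y : ℝ) : ℝ :=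
  (logMoment 0 (Real.pi * y) / (2 * Real.sqrt y)
    - Real.pi * Real.sqrt y * logMoment 1 (Real.pi * y)) / (4 * Real.pi)

/-- The second derivative of `alpha`. -/
def alphaDeriv₂ (y : ℝ) : ℝ := 1 / (8 * Real.pi * y ^ 2) - (1 / (2 * y) - Real.pi) * alphaDeriv y

lemma hasDerivAt_logMoment_pi (j : ℕ) {y : ℝ} (hy : 0 < y) :
    HasDerivAt (fun y => logMoment j (Real.pi * y))
      (-logMoment (j + 1) (Real.pi * y) * Real.pi) y := by
  have h : HasDerivAt (fun y => Real.pi * y) Real.pi y := by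
    simpa using (hasDerivAt_id y).const_mul Real.pi
  exact (hasDerivAt_logMoment j (mul_pos Real.pi_pos hy)).comp y h

lemma hasDerivAt_alpha {y : ℝ} (hy : 0 < y) : HasDerivAt alpha (alphaDeriv y) y := by
  have h0 : 0 < Real.sqrt y := Real.sqrt_pos.2 hy
  have := ((Real.hasDerivAt_sqrt hy.ne').div_const (4 * Real.pi)).mul (hasDerivAt_logMoment_pi 0 hy)
  rw [show alpha = fun y => Real.sqrt y / (4 * Real.pi) * logMoment 0 (Real.pi * y) from
    funext alpha_eq]
  refine this.congr_deriv ?_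
  unfold alphaDeriv
  field_simp
  ring

/-- Differentiation brings in the second moment; `logMoment_relation` at `s = πy` eliminates it. The
Gamma integral in that relation produces the inhomogeneity `1/(8πy²)`. -/
lemma hasDerivAt_alphaDeriv {y : ℝ} (hy : 0 < y) :
    HasDerivAt alphaDeriv (alphaDeriv₂ y) y := by
  have h0 : 0 < Real.sqrt y := Real.sqrt_pos.2 hy
  have h1 : Real.sqrt y ^ 2 = y := Real.sq_sqrt hy.le
  have hr := Real.hasDerivAt_sqrt hy.ne'
  have := (((hasDerivAt_logMoment_pi 0 hy).div (hr.const_mul 2) (by positivity)).sub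
    ((hr.const_mul Real.pi).mul (hasDerivAt_logMoment_pi 1 hy))).div_const (4 * Real.pi)
  refine this.congr_deriv ?_
  have rel := logMoment_relation (mul_pos Real.pi_pos hy)
  rw [Real.sqrt_mul Real.pi_pos.le] at rel
  unfold alphaDeriv₂ alphaDeriv
  have hp := Real.pi_pos
  have hsp : 0 < Real.sqrt Real.pi := Real.sqrt_pos.2 hp
  generalize hL0 : logMoment 0 (Real.pi * y) = L0 at *
  generalize hL1 : logMoment 1 (Real.pi * y) = L1 at *
  generalize hL2 : logMoment 2 (Real.pi * y) = L2 at *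
  generalize hrr : Real.sqrt y = r at *
  subst h1
  field_simp at rel ⊢
  simp only [hL1, hL2] at *
  linear_combination (-16) * rel

lemma alpha_nonneg (y : ℝ) : 0 ≤ alpha y := by
  rw [alpha_eq]
  refine mul_nonneg (by positivity) (setIntegral_nonneg measurableSet_Ioi fun t ht => ?_)
  exact mul_nonneg (mul_nonneg (by positivity) (logWeight_nonneg ht)) (Real.exp_pos _).le

/-- Replacing `logWeight` by its square-root majorant gives `1/(8π²y)`; the constant is then
discarded. -/
lemma alpha_le {y : ℝ} (hy : 0 < y) : alpha y ≤ 1 / y := by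
  have hp := Real.pi_pos
  have hs := mul_pos hp hy
  have h : logMoment 0 (Real.pi * y) ≤
      Real.sqrt Real.pi / (2 * (Real.pi * y * Real.sqrt (Real.pi * y))) := by
    rw [← integral_sqrt_mul_exp hs]
    refine setIntegral_mono_on (integrableOn_logMoment 0 _ hs) (integrableOn_sqrt_mul_exp hs)
      measurableSet_Ioi fun t ht => ?_
    have := logWeight_le ht
    rw [pow_zero, one_mul]
    gcongr
  rw [alpha_eq]
  calc _ ≤ Real.sqrt y / (4 * Real.pi) *
        (Real.sqrt Real.pi / (2 * (Real.pi * y * Real.sqrt (Real.pi * y)))) := by gcongr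
    _ = 1 / (8 * Real.pi ^ 2) * (1 / y) := by
      rw [Real.sqrt_mul hp.le]
      have h0 : 0 < Real.sqrt y := Real.sqrt_pos.2 hy
      have hsp : 0 < Real.sqrt Real.pi := Real.sqrt_pos.2 hp
      field_simp; norm_num
    _ ≤ 1 * (1 / y) := by
      gcongr
      rw [div_le_one (by positivity)]
      nlinarith [Real.pi_gt_three]
    _ = _ := one_mul _

/-! ### The function `beta` -/

/-- The integrand of the incomplete Gamma function in `beta`. -/
def betaIntegrand (t : ℝ) : ℂ := (t : ℂ) ^ (-(1 / 2) : ℂ) * Complex.exp (-(t : ℂ))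

/-- On the positive axis this is the integrand of `Γ(1/2)`; on `(a, 0]` the only singularity is of
order `1/2`. -/
lemma integrableOn_betaIntegrand (a : ℝ) : IntegrableOn betaIntegrand (Ioi a) := by
  have h0 : IntegrableOn betaIntegrand (Ioi 0) := by
    refine (Complex.GammaIntegral_convergent (s := 1 / 2) (by norm_num)).congr_fun
      (fun t _ => ?_) measurableSet_Ioi
    simp only [betaIntegrand]
    push_cast
    rw [mul_comm, show (1 / 2 : ℂ) - 1 = -(1 / 2) by norm_num]
  have h1 : IntegrableOn betaIntegrand (Ioc a 0) := by
    rcases le_total a 0 with ha | ha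
    · rw [← intervalIntegrable_iff_integrableOn_Ioc_of_le ha]
      refine (intervalIntegral.intervalIntegrable_cpow' (by norm_num)).mul_continuousOn ?_
      fun_prop
    · simp [Ioc_eq_empty_of_le ha]
  exact (h1.union h0).mono_set fun t ht => (le_or_gt t 0).elim (fun h => .inl ⟨ht, h⟩) .inr

/-- The derivative of `beta`. -/
def betaDeriv (y : ℝ) : ℂ := -(Real.sqrt Real.pi : ℂ) * betaIntegrand (Real.pi * y)

lemma continuousAt_betaIntegrand {t : ℝ} (ht : t ≠ 0) : ContinuousAt betaIntegrand t := by
  unfold betaIntegrand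
  refine ContinuousAt.mul ?_ (by fun_prop)
  rcases lt_or_gt_of_ne ht with h | h
  -- The negative axis is the branch cut, so the power is rewritten as `(-t)^{-1/2}` times a
  -- constant phase; the first summand is zero.
  · have : ContinuousAt (fun t : ℝ => Complex.I ^ (1 : ℕ) * 0 + (-(t : ℂ)) ^ (-(1 / 2) : ℂ)
        * Complex.exp (Real.pi * Complex.I * (-(1 / 2)))) t := by
      refine ContinuousAt.add (by fun_prop) (ContinuousAt.mul ?_ (by fun_prop))
      refine ContinuousAt.cpow (by fun_prop) (by fun_prop) ?_
      left; simpa using h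
    refine this.congr ?_
    filter_upwards [Iio_mem_nhds h] with u hu
    rw [Complex.ofReal_cpow_of_nonpos (le_of_lt hu)]; simp
  · refine ContinuousAt.cpow (by fun_prop) (by fun_prop) ?_
    left; simpa using h

lemma hasDerivAt_beta {y : ℝ} (hy : y ≠ 0) : HasDerivAt beta (betaDeriv y) y := by
  have hp := Real.pi_pos
  have hpy : Real.pi * y ≠ 0 := mul_ne_zero hp.ne' hy
  -- Any base point below `πy` serves: it turns the improper integral into a constant minus an
  -- interval integral with variable upper end.
  set a := Real.pi * y - 1
  have hint : ∀ b, IntervalIntegrable betaIntegrand volume a b := fun b => by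
    rw [intervalIntegrable_iff]
    exact (integrableOn_betaIntegrand (min a b)).mono_set Ioc_subset_Ioi_self
  have h1 : beta = fun y => ((1 / Real.sqrt Real.pi : ℝ) : ℂ) *
      ((∫ t in Ioi a, betaIntegrand t) - ∫ t in a..(Real.pi * y), betaIntegrand t) := by
    ext u
    rw [intervalIntegral.integral_Ioi_sub_Ioi' (integrableOn_betaIntegrand _)
      (integrableOn_betaIntegrand _) |>.symm]
    simp [beta, betaIntegrand]
  rw [h1]
  have hm : StronglyMeasurableAtFilter betaIntegrand (𝓝 (Real.pi * y)) volume :=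
    ⟨Ioi a, Ioi_mem_nhds (by simp [a]), (integrableOn_betaIntegrand a).aestronglyMeasurable⟩
  have h2 := intervalIntegral.integral_hasDerivAt_right (hint (Real.pi * y)) hm
    (continuousAt_betaIntegrand hpy)
  have h3 : HasDerivAt (fun y => Real.pi * y) Real.pi y := by
    simpa using (hasDerivAt_id y).const_mul Real.pi
  have h4 := ((h2.scomp y h3).const_sub (∫ t in Ioi a, betaIntegrand t)).const_mul
    ((1 / Real.sqrt Real.pi : ℝ) : ℂ)
  refine h4.congr_deriv ?_
  unfold betaDeriv
  have hsp : (Real.sqrt Real.pi : ℂ) ≠ 0 := by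
    exact_mod_cast (Real.sqrt_pos.2 hp).ne'
  have h5 : (Real.pi : ℂ) = (Real.sqrt Real.pi : ℂ) ^ 2 := by
    rw [← Complex.ofReal_pow, Real.sq_sqrt hp.le]
  rw [Complex.real_smul]
  push_cast
  rw [h5]
  field_simp

lemma beta_ofReal {s : ℝ} (hs : 0 < s) :
    beta s = ((1 / Real.sqrt Real.pi *
      ∫ t in Ioi (Real.pi * s), t ^ (-(1 / 2) : ℝ) * Real.exp (-t) : ℝ) : ℂ) := by
  unfold beta
  rw [Complex.ofReal_mul, ← integral_complex_ofReal]
  congr 1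
  refine setIntegral_congr_fun measurableSet_Ioi fun t ht => ?_
  have ht : 0 < t := (mul_pos Real.pi_pos hs).trans ht
  rw [Complex.ofReal_mul, Complex.ofReal_cpow ht.le]
  push_cast
  rfl

/-- Shift the integration variable by `πδ`: the exponential gains exactly `e^{-πδ}` and `t^{-1/2}`
only decreases. -/
lemma norm_beta_add_le {s δ : ℝ} (hs : 0 < s) (hδ : 0 ≤ δ) :
    ‖beta (s + δ)‖ ≤ Real.exp (-(Real.pi * δ)) * ‖beta s‖ := by
  have hp := Real.pi_pos
  have hps := mul_pos hp hs
  set ρ : ℝ → ℝ := fun t => t ^ (-(1 / 2) : ℝ) * Real.exp (-t)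
  have hρ0 : ∀ t > 0, 0 ≤ ρ t := fun t ht => by positivity
  have hρi : ∀ a > 0, IntegrableOn ρ (Ioi a) := fun a ha => by
    have hn : IntegrableOn (fun t => ‖betaIntegrand t‖) (Ioi a) :=
      (integrableOn_betaIntegrand a).norm
    refine hn.congr_fun (fun t ht => ?_) measurableSet_Ioi
    have ht : 0 < t := lt_trans ha ht
    simp only [betaIntegrand, ρ]
    rw [norm_mul, Complex.norm_cpow_eq_rpow_re_of_pos ht, Complex.norm_exp]
    simp
  have hn : ∀ u > 0, ‖beta u‖ = 1 / Real.sqrt Real.pi * ∫ t in Ioi (Real.pi * u), ρ t := by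
    intro u hu
    rw [beta_ofReal hu, Complex.norm_real, Real.norm_of_nonneg]
    exact mul_nonneg (by positivity) (setIntegral_nonneg measurableSet_Ioi fun t ht =>
      hρ0 t ((mul_pos hp hu).trans ht))
  rw [hn _ hs, hn _ (by linarith), mul_left_comm]
  gcongr
  set d := Real.pi * δ
  have hd : 0 ≤ d := by positivity
  have hmp := (measurePreserving_add_right (volume : Measure ℝ) d)
  have hshift := hmp.setIntegral_preimage_emb (measurableEmbedding_addRight d) ρ
    (Ioi (Real.pi * (s + δ)))
  have hpre : (fun x => x + d) ⁻¹' Ioi (Real.pi * (s + δ)) = Ioi (Real.pi * s) := by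
    ext x; simp [d, mul_add]
  have hint := hmp.integrableOn_comp_preimage (measurableEmbedding_addRight d) (f := ρ)
    (s := Ioi (Real.pi * (s + δ)))
  rw [hpre] at hshift hint
  rw [← hshift, ← integral_const_mul]
  refine setIntegral_mono_on (hint.2 (hρi _ (by positivity))) ((hρi _ hps).const_mul _)
    measurableSet_Ioi fun t ht => ?_
  have ht : 0 < t := hps.trans ht
  simp only [ρ]
  have h1 : (t + d) ^ (-(1 / 2) : ℝ) ≤ t ^ (-(1 / 2) : ℝ) :=
    Real.rpow_le_rpow_of_nonpos ht (by linarith) (by norm_num)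
  rw [neg_add, Real.exp_add]
  calc (t + d) ^ (-(1 / 2) : ℝ) * (Real.exp (-t) * Real.exp (-d))
      ≤ t ^ (-(1 / 2) : ℝ) * (Real.exp (-t) * Real.exp (-d)) := by gcongr
    _ = _ := by ring

lemma tendsto_beta_atTop : Tendsto beta atTop (𝓝 0) := by
  have hp := Real.pi_pos
  rw [tendsto_zero_iff_norm_tendsto_zero]
  have h : Tendsto (fun s => Real.exp (-(Real.pi * (s - 1))) * ‖beta 1‖) atTop (𝓝 0) := by
    rw [← zero_mul ‖beta 1‖]
    refine Tendsto.mul_const _ (Real.tendsto_exp_neg_atTop_nhds_zero.comp ?_)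
    exact (tendsto_atTop_add_const_right _ (-1) tendsto_id).const_mul_atTop hp
  refine squeeze_zero' (Eventually.of_forall fun _ => norm_nonneg _) ?_ h
  filter_upwards [eventually_ge_atTop 1] with s hs
  have := norm_beta_add_le one_pos (sub_nonneg.2 hs)
  rwa [add_sub_cancel] at this

/-- The phase of the principal branch is `-i`, so along the negative axis only the imaginary part of
`beta` varies, and monotonically. Its growth can therefore be read off from a real derivative. -/
lemma betaDeriv_neg {s : ℝ} (hs : 0 < s) :
    betaDeriv (-s) = Complex.I * (s ^ (-(1 / 2) : ℝ) * Real.exp (Real.pi * s) : ℝ) := by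
  have hp := Real.pi_pos
  unfold betaDeriv betaIntegrand
  have e : Real.pi * -s = -(Real.pi * s) := by ring
  rw [e, Complex.ofReal_cpow_of_nonpos (neg_nonpos.2 (by positivity)),
    show -((-(Real.pi * s) : ℝ) : ℂ) = ((Real.pi * s : ℝ) : ℂ) by push_cast; ring,
    show (-(1 / 2) : ℂ) = ((-(1 / 2) : ℝ) : ℂ) by push_cast; ring,
    ← Complex.ofReal_cpow (by positivity), Real.mul_rpow hp.le hs.le,
    show (Real.pi : ℂ) * Complex.I * ((-(1 / 2) : ℝ) : ℂ) = -(Real.pi / 2 * Complex.I) by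
      push_cast; ring,
    Complex.exp_neg, Complex.exp_pi_div_two_mul_I, Complex.inv_I, Real.rpow_neg hp.le,
    ← Real.sqrt_eq_rpow, ← Complex.ofReal_exp]
  have hsp : (Real.sqrt Real.pi : ℂ) ≠ 0 := by exact_mod_cast (Real.sqrt_pos.2 hp).ne'
  push_cast
  field_simp

lemma betaDeriv_pos {s : ℝ} (hs : 0 < s) :
    betaDeriv s = -((s ^ (-(1 / 2) : ℝ) * Real.exp (-(Real.pi * s)) : ℝ) : ℂ) := by
  have hp := Real.pi_pos
  unfold betaDeriv betaIntegrand
  rw [show (-(1 / 2) : ℂ) = ((-(1 / 2) : ℝ) : ℂ) by push_cast; ring,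
    ← Complex.ofReal_cpow (by positivity), Real.mul_rpow hp.le hs.le, Real.rpow_neg hp.le,
    ← Real.sqrt_eq_rpow]
  have hsp : (Real.sqrt Real.pi : ℂ) ≠ 0 := by exact_mod_cast (Real.sqrt_pos.2 hp).ne'
  push_cast
  field_simp

/-- On the negative axis `beta` grows like `exp (π s)`, up to powers of `s`. -/
lemma eq_zero_of_beta_neg_le {b : ℂ} {M r s₀ : ℝ} (hr : r < Real.pi)
    (h : ∀ s ≥ s₀, ‖b * beta (-s)‖ ≤ M * Real.exp (r * s)) : b = 0 := by
  have hp := Real.pi_pos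
  have key : ∀ s ≥ max s₀ 1, ‖b‖ ≤ M * (Real.exp r + 1) *
      (Real.exp (Real.pi - r) * ((s + 1) ^ (1 / 2 : ℝ) * Real.exp (-(Real.pi - r) * (s + 1)))) := by
    intro s hs
    have hs0 : s₀ ≤ s := le_of_max_le_left hs
    have hs1 : 1 ≤ s := le_of_max_le_right hs
    have hd : ∀ u > 0, HasDerivAt (fun u : ℝ => -(beta (-u)).im)
        (u ^ (-(1 / 2) : ℝ) * Real.exp (Real.pi * u)) u := by
      intro u hu
      have h1 := (hasDerivAt_beta (neg_ne_zero.2 hu.ne')).scomp u (hasDerivAt_neg u)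
      have h2 := (Complex.imCLM.hasFDerivAt.comp_hasDerivAt u h1).fun_neg
      refine h2.congr_deriv ?_
      rw [betaDeriv_neg hu, neg_one_smul, map_neg, neg_neg, Complex.imCLM_apply, Complex.I_mul_im,
        Complex.ofReal_re]
    -- The mean value theorem on `[s, s + 1]` bounds `‖β(-s-1)‖ + ‖β(-s)‖` below by `(s+1)^{-1/2}
    -- e^{πs}`. The assumed bound at both points then makes `‖b‖` smaller than a quantity tending to
    -- `0`, since `r < π`.
    obtain ⟨c, hc, hc'⟩ := exists_hasDerivAt_eq_slope _ _ (lt_add_one s)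
      (fun u hu => (hd u (by linarith [hu.1])).continuousAt.continuousWithinAt)
      (fun u hu => hd u (by linarith [hu.1]))
    have hlow : (s + 1) ^ (-(1 / 2) : ℝ) * Real.exp (Real.pi * s) ≤
        ‖beta (-(s + 1))‖ + ‖beta (-s)‖ := by
      have hc0 : 0 < c := by linarith [hc.1]
      have h1 : (s + 1) ^ (-(1 / 2) : ℝ) ≤ c ^ (-(1 / 2) : ℝ) :=
        Real.rpow_le_rpow_of_nonpos hc0 hc.2.le (by norm_num)
      have h2 : Real.exp (Real.pi * s) ≤ Real.exp (Real.pi * c) := by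
        have := hc.1; gcongr
      have h3 := mul_le_mul h1 h2 (Real.exp_pos _).le (by positivity)
      rw [hc'] at h3
      have h4 := Complex.abs_im_le_norm (beta (-(s + 1)))
      have h5 := Complex.abs_im_le_norm (beta (-s))
      have h6 := neg_le_abs (beta (-(s + 1))).im
      have h7 := le_abs_self (beta (-s)).im
      rw [add_sub_cancel_left, div_one] at h3
      linarith
    have h1 := h s hs0
    have h2 := h (s + 1) (by linarith)
    rw [norm_mul] at h1 h2
    have h3 : ‖b‖ * ((s + 1) ^ (-(1 / 2) : ℝ) * Real.exp (Real.pi * s)) ≤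
        M * (Real.exp r + 1) * Real.exp (r * s) := by
      calc _ ≤ ‖b‖ * (‖beta (-(s + 1))‖ + ‖beta (-s)‖) := by gcongr
        _ ≤ M * Real.exp (r * (s + 1)) + M * Real.exp (r * s) := by linarith
        _ = _ := by rw [mul_add r, Real.exp_add, mul_one]; ring
    have hpos : 0 < s + 1 := by linarith
    have e1 : (s + 1) ^ (1 / 2 : ℝ) * (s + 1) ^ (-(1 / 2) : ℝ) = 1 := by
      rw [← Real.rpow_add hpos]; norm_num
    have e2 : Real.exp (Real.pi - r) * Real.exp (-(Real.pi - r) * (s + 1)) =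
        Real.exp (r * s) * Real.exp (-(Real.pi * s)) := by
      rw [← Real.exp_add, ← Real.exp_add]; ring_nf
    have e3 : Real.exp (Real.pi * s) * Real.exp (-(Real.pi * s)) = 1 := by
      rw [← Real.exp_add]; simp
    calc ‖b‖ = ‖b‖ * ((s + 1) ^ (-(1 / 2) : ℝ) * Real.exp (Real.pi * s)) *
          ((s + 1) ^ (1 / 2 : ℝ) * Real.exp (-(Real.pi * s))) := by
          linear_combination (-‖b‖) * e1 - ‖b‖ * e3 * ((s + 1) ^ (1 / 2 : ℝ) * (s + 1) ^ (-(1 / 2) : ℝ))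
      _ ≤ M * (Real.exp r + 1) * Real.exp (r * s) *
          ((s + 1) ^ (1 / 2 : ℝ) * Real.exp (-(Real.pi * s))) := by gcongr
      _ = _ := by linear_combination (-(M * (Real.exp r + 1) * (s + 1) ^ (1 / 2 : ℝ))) * e2
  have hlim : Tendsto (fun s : ℝ => M * (Real.exp r + 1) *
      (Real.exp (Real.pi - r) * ((s + 1) ^ (1 / 2 : ℝ) * Real.exp (-(Real.pi - r) * (s + 1)))))
      atTop (𝓝 0) := by
    have := (((tendsto_rpow_mul_exp_neg_mul_atTop_nhds_zero (1 / 2) (Real.pi - r)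
      (sub_pos.2 hr)).comp (tendsto_atTop_add_const_right _ 1 tendsto_id)).const_mul
      (Real.exp (Real.pi - r))).const_mul (M * (Real.exp r + 1))
    simpa using this
  have := ge_of_tendsto hlim ((eventually_ge_atTop (max s₀ 1)).mono key)
  exact norm_le_zero_iff.1 this

/-! ### Fourier coefficients of periodic functions on the upper half plane -/

lemma isOpen_im_pos : IsOpen {z : ℂ | 0 < z.im} := isOpen_lt continuous_const Complex.continuous_im

lemma im_add_mul_I_pos {x y : ℝ} (hy : 0 < y) : 0 < ((x : ℂ) + y * Complex.I).im := by simpa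

lemma coe_ofComplex {z : ℂ} (hz : 0 < z.im) : ((ofComplex z : ℍ) : ℂ) = z := by
  rw [ofComplex_apply_of_im_pos hz]

lemma RealAnalytic.fderiv_apply {F : ℍ → ℂ} (hF : RealAnalytic F) (v : ℂ) :
    RealAnalytic (fun z => fderiv ℝ (F ∘ ofComplex) (z : ℂ) v) := by
  have h := (ContinuousLinearMap.apply ℝ ℂ v).comp_analyticOnNhd hF.fderiv
  refine h.congr isOpen_im_pos fun z hz => ?_
  simp [coe_ofComplex hz]

lemma RealAnalytic.dx {F : ℍ → ℂ} (hF : RealAnalytic F) : RealAnalytic (dx F) :=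
  hF.fderiv_apply 1

lemma RealAnalytic.dy {F : ℍ → ℂ} (hF : RealAnalytic F) : RealAnalytic (dy F) :=
  hF.fderiv_apply Complex.I

/-- Invariance under `z ↦ z + 1`. -/
def OnePeriodic (F : ℍ → ℂ) : Prop := ∀ z : ℍ, F ((1 : ℝ) +ᵥ z) = F z

lemma OnePeriodic.comp_ofComplex {F : ℍ → ℂ} (hF : OnePeriodic F) (z : ℂ) :
    (F ∘ ofComplex) (z + 1) = (F ∘ ofComplex) z := by
  simp only [Function.comp]
  rcases lt_or_ge 0 z.im with hz | hz
  · rw [← hF (ofComplex z)]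
    congr 1
    ext
    rw [coe_ofComplex (by simpa using hz), coe_vadd, coe_ofComplex hz]
    push_cast; ring
  -- Outside the half plane `ofComplex` takes a constant default value, so the composite is periodic
  -- on all of `ℂ`, and translation can be carried through `fderiv`.
  · rw [ofComplex_apply_of_im_nonpos hz, ofComplex_apply_of_im_nonpos (by simpa using hz)]

lemma OnePeriodic.fderiv_apply {F : ℍ → ℂ} (hF : OnePeriodic F) (v : ℂ) :
    OnePeriodic (fun z => fderiv ℝ (F ∘ ofComplex) (z : ℂ) v) := by
  intro z
  simp only [coe_vadd]
  rw [show ((1 : ℝ) : ℂ) + (z : ℂ) = z + 1 by push_cast; ring, ← fderiv_comp_add_right]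
  simp_rw [hF.comp_ofComplex]

lemma OnePeriodic.dx {F : ℍ → ℂ} (hF : OnePeriodic F) : OnePeriodic (dx F) := hF.fderiv_apply 1

lemma OnePeriodic.dy {F : ℍ → ℂ} (hF : OnePeriodic F) : OnePeriodic (dy F) :=
  hF.fderiv_apply Complex.I

lemma RealAnalytic.hasFDerivAt {F : ℍ → ℂ} (hF : RealAnalytic F) {z : ℂ} (hz : 0 < z.im) :
    HasFDerivAt (F ∘ ofComplex) (fderiv ℝ (F ∘ ofComplex) z) z :=
  (hF z hz).differentiableAt.hasFDerivAt

lemma RealAnalytic.hasDerivAt_x {F : ℍ → ℂ} (hF : RealAnalytic F) {y : ℝ} (hy : 0 < y) (x : ℝ) :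
    HasDerivAt (fun x : ℝ => (F ∘ ofComplex) (x + y * Complex.I))
      ((Sesqui.dx F ∘ ofComplex) (x + y * Complex.I)) x := by
  have hz := im_add_mul_I_pos (x := x) hy
  have h1 : HasDerivAt (fun x : ℝ => (x : ℂ) + y * Complex.I) 1 x :=
    Complex.ofRealCLM.hasDerivAt.add_const _
  have := (hF.hasFDerivAt hz).comp_hasDerivAt x h1
  simpa [Function.comp_def, Sesqui.dx, coe_ofComplex hz] using this

lemma RealAnalytic.hasDerivAt_y {F : ℍ → ℂ} (hF : RealAnalytic F) {y : ℝ} (hy : 0 < y) (x : ℝ) :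
    HasDerivAt (fun y : ℝ => (F ∘ ofComplex) (x + y * Complex.I))
      ((Sesqui.dy F ∘ ofComplex) (x + y * Complex.I)) y := by
  have hz := im_add_mul_I_pos (x := x) hy
  have h1 : HasDerivAt (fun y : ℝ => (x : ℂ) + y * Complex.I) Complex.I y := by
    simpa using (Complex.ofRealCLM.hasDerivAt (x := y)).mul_const Complex.I |>.const_add (x : ℂ)
  have := (hF.hasFDerivAt hz).comp_hasDerivAt y h1
  simpa [Function.comp_def, Sesqui.dy, coe_ofComplex hz] using this

lemma RealAnalytic.continuous_x {F : ℍ → ℂ} (hF : RealAnalytic F) {y : ℝ} (hy : 0 < y) :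
    Continuous (fun x : ℝ => (F ∘ ofComplex) (x + y * Complex.I)) :=
  continuous_iff_continuousAt.2 fun x => (hF.hasDerivAt_x hy x).continuousAt

/-- The `n`-th Fourier coefficient of `F` on the horizontal line of height `y`. -/
def coeff (F : ℍ → ℂ) (n : ℤ) (y : ℝ) : ℂ :=
  ∫ x in (0 : ℝ)..1, Complex.exp (-(2 * Real.pi * Complex.I * n) * x) *
    (F ∘ ofComplex) (x + y * Complex.I)

lemma continuous_exp_mul (c : ℂ) : Continuous (fun x : ℝ => Complex.exp (c * x)) := by fun_prop

lemma norm_exp_int (n : ℤ) (x : ℝ) :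
    ‖Complex.exp (-(2 * Real.pi * Complex.I * n) * x)‖ = 1 := by
  rw [Complex.norm_exp]; simp

lemma RealAnalytic.continuous_integrand {F : ℍ → ℂ} (hF : RealAnalytic F) (n : ℤ) {y : ℝ}
    (hy : 0 < y) : Continuous (fun x : ℝ => Complex.exp (-(2 * Real.pi * Complex.I * n) * x) *
    (F ∘ ofComplex) (x + y * Complex.I)) :=
  (continuous_exp_mul _).mul (hF.continuous_x hy)

/-- Integration by parts; the boundary terms cancel by periodicity. -/
lemma coeff_dx {F : ℍ → ℂ} (hF : RealAnalytic F) (hp : OnePeriodic F) (n : ℤ) {y : ℝ}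
    (hy : 0 < y) : coeff (dx F) n y = 2 * Real.pi * Complex.I * n * coeff F n y := by
  set c : ℂ := -(2 * Real.pi * Complex.I * n)
  have he : ∀ x : ℝ, HasDerivAt (fun x : ℝ => Complex.exp (c * x)) (c * Complex.exp (c * x)) x := by
    intro x
    have : HasDerivAt (fun x : ℝ => c * (x : ℂ)) c x := by
      simpa using (Complex.ofRealCLM.hasDerivAt (x := x)).const_mul c
    simpa [mul_comm] using this.cexp
  have := intervalIntegral.integral_mul_deriv_eq_deriv_mul (a := 0) (b := 1)
    (fun x _ => he x) (fun x _ => hF.hasDerivAt_x hy x)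
    (((continuous_exp_mul c).const_smul c).intervalIntegrable _ _)
    ((hF.dx.continuous_x hy).intervalIntegrable _ _)
  unfold coeff
  rw [this]
  have e1 : Complex.exp (c * (1 : ℝ)) = 1 := by
    rw [Complex.exp_eq_one_iff]; exact ⟨-n, by simp [c]; ring⟩
  have e2 : (F ∘ ofComplex) (((1 : ℝ) : ℂ) + y * Complex.I) =
      (F ∘ ofComplex) (((0 : ℝ) : ℂ) + y * Complex.I) := by
    rw [← hp.comp_ofComplex (((0 : ℝ) : ℂ) + _)]; congr 1; push_cast; ring
  rw [e1, e2]
  simp only [mul_assoc]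
  rw [intervalIntegral.integral_const_mul]
  simp [c, mul_assoc]

lemma hasDerivAt_coeff {F : ℍ → ℂ} (hF : RealAnalytic F) (n : ℤ) {y : ℝ} (hy : 0 < y) :
    HasDerivAt (coeff F n) (coeff (dy F) n y) y := by
  -- Compactness of `[0,1] × [y/2, 2y]` supplies the constant dominating the `y`-derivative.
  have hc : ContinuousOn (fun p : ℝ × ℝ => (Sesqui.dy F ∘ ofComplex) (p.1 + p.2 * Complex.I))
      (Icc 0 1 ×ˢ Icc (y / 2) (2 * y)) := by
    have h1 : ContinuousOn (Sesqui.dy F ∘ ofComplex) {z : ℂ | 0 < z.im} := hF.dy.continuousOn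
    refine h1.comp (by fun_prop) fun p hp => ?_
    have := hp.2.1
    exact im_add_mul_I_pos (by linarith)
  obtain ⟨M, hM⟩ := (isCompact_Icc.prod isCompact_Icc).exists_bound_of_continuousOn hc
  have key := intervalIntegral.hasDerivAt_integral_of_dominated_loc_of_deriv_le
    (μ := volume) (a := 0) (b := 1) (x₀ := y) (s := Icc (y / 2) (2 * y))
    (F := fun (y : ℝ) x => Complex.exp (-(2 * Real.pi * Complex.I * n) * x) *
      (F ∘ ofComplex) (x + y * Complex.I))
    (F' := fun (y : ℝ) x => Complex.exp (-(2 * Real.pi * Complex.I * n) * x) *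
      (Sesqui.dy F ∘ ofComplex) (x + y * Complex.I)) (bound := fun _ => M)
    (Icc_mem_nhds (by linarith) (by linarith))
    (by
      filter_upwards [Ioi_mem_nhds hy] with r hr
      exact (hF.continuous_integrand n hr).aestronglyMeasurable)
    ((hF.continuous_integrand n hy).intervalIntegrable _ _)
    (hF.dy.continuous_integrand n hy).aestronglyMeasurable
    (by
      filter_upwards with x hx r hr
      rw [uIoc_of_le zero_le_one] at hx
      rw [norm_mul, norm_exp_int, one_mul]
      exact hM (x, r) ⟨Ioc_subset_Icc_self hx, hr⟩)
    intervalIntegrable_const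
    (by
      filter_upwards with x _ r hr
      exact (hF.hasDerivAt_y (by linarith [hr.1]) x).const_mul _)
  exact key.2

lemma norm_coeff_le {F : ℍ → ℂ} (n : ℤ) {y M : ℝ}
    (h : ∀ x : ℝ, ‖(F ∘ ofComplex) (x + y * Complex.I)‖ ≤ M) : ‖coeff F n y‖ ≤ M := by
  have := intervalIntegral.norm_integral_le_of_norm_le_const (a := (0 : ℝ)) (b := 1) (C := M)
    (f := fun x : ℝ => Complex.exp (-(2 * Real.pi * Complex.I * n) * x) *
      (F ∘ ofComplex) (x + y * Complex.I)) (fun x _ => by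
        rw [norm_mul, norm_exp_int, one_mul]; exact h x)
  simpa [coeff] using this

/-- The point is that `M` does not depend on `n`; convergence rests on this uniformity at half the
height. -/
lemma exists_norm_coeff_le {F : ℍ → ℂ} (hF : RealAnalytic F) {y : ℝ} (hy : 0 < y) :
    ∃ M, ∀ n, ‖coeff F n y‖ ≤ M := by
  obtain ⟨M, hM⟩ := isCompact_Icc.exists_bound_of_continuousOn
    ((hF.continuous_x hy).continuousOn (s := Icc 0 1))
  refine ⟨M, fun n => ?_⟩
  have := intervalIntegral.norm_integral_le_of_norm_le_const (a := (0 : ℝ)) (b := 1) (C := M)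
    (f := fun x : ℝ => Complex.exp (-(2 * Real.pi * Complex.I * n) * x) *
      (F ∘ ofComplex) (x + y * Complex.I)) (fun x hx => by
        rw [uIoc_of_le zero_le_one] at hx
        rw [norm_mul, norm_exp_int, one_mul]; exact hM x (Ioc_subset_Icc_self hx))
  simpa [coeff] using this

lemma RealAnalytic.laplacian {F : ℍ → ℂ} (hF : RealAnalytic F) (k : ℝ) :
    RealAnalytic (laplacian k F) := by
  have him : AnalyticOnNhd ℝ (fun z : ℂ => (z.im : ℂ)) {z : ℂ | 0 < z.im} := fun z _ =>
    (Complex.ofRealCLM.comp Complex.imCLM).analyticAt z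
  have hc : ∀ c : ℂ, AnalyticOnNhd ℝ (fun _ : ℂ => c) {z : ℂ | 0 < z.im} := fun c =>
    analyticOnNhd_const
  have h := ((him.pow 2).neg.mul (hF.dx.dx.add hF.dy.dy)).add
    ((((hc Complex.I).mul (hc k)).mul him).mul (hF.dx.add ((hc Complex.I).mul hF.dy)))
  refine h.congr isOpen_im_pos fun z hz => ?_
  have e : (ofComplex z : ℍ).im = z.im := by rw [← coe_im, coe_ofComplex hz]
  simp [Sesqui.laplacian, e]

lemma coeff_laplacian {F : ℍ → ℂ} (hF : RealAnalytic F) (k : ℝ) (n : ℤ) {y : ℝ} (hy : 0 < y) :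
    coeff (laplacian k F) n y = -(y : ℂ) ^ 2 * (coeff (dx (dx F)) n y + coeff (dy (dy F)) n y)
      + Complex.I * k * y * (coeff (dx F) n y + Complex.I * coeff (dy F) n y) := by
  have i1 := (hF.dx.dx.continuous_integrand n hy).intervalIntegrable (μ := volume) 0 1
  have i2 := (hF.dy.dy.continuous_integrand n hy).intervalIntegrable (μ := volume) 0 1
  have i3 := (hF.dx.continuous_integrand n hy).intervalIntegrable (μ := volume) 0 1
  have i4 := (hF.dy.continuous_integrand n hy).intervalIntegrable (μ := volume) 0 1
  unfold coeff
  rw [← intervalIntegral.integral_add i1 i2, ← intervalIntegral.integral_const_mul,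
    ← intervalIntegral.integral_const_mul, ← intervalIntegral.integral_add i3 (i4.const_mul _),
    ← intervalIntegral.integral_const_mul, ← intervalIntegral.integral_add
      ((i1.add i2).const_mul _) ((i3.add (i4.const_mul _)).const_mul _)]
  refine intervalIntegral.integral_congr fun x _ => ?_
  have e : (ofComplex ((x : ℂ) + y * Complex.I) : ℍ).im = y := by
    rw [← coe_im, coe_ofComplex (im_add_mul_I_pos hy)]; simp
  simp only [Function.comp, laplacian, e]
  ring

/-- A one-periodic real-analytic function is the sum of its Fourier series, if that converges. -/
lemma hasSum_coeff {F : ℍ → ℂ} (hF : RealAnalytic F) (hp : OnePeriodic F) (z : ℍ)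
    (hs : Summable (fun n : ℤ => coeff F n z.im)) :
    HasSum (fun n : ℤ => coeff F n z.im * Complex.exp (2 * Real.pi * Complex.I * n * z.re)) (F z) := by
  set g : ℝ → ℂ := fun x => (F ∘ ofComplex) (x + z.im * Complex.I)
  have hg : Function.Periodic g 1 := fun x => by
    simp only [g]
    rw [← hp.comp_ofComplex ((x : ℂ) + _)]; congr 1; push_cast; ring
  have hgc : Continuous g := hF.continuous_x z.im_pos
  let G : C(UnitAddCircle, ℂ) := ⟨hg.lift, by
    apply continuous_coinduced_dom.mpr
    exact hgc⟩
  have hG : ∀ x : ℝ, G x = g x := fun x => hg.lift_coe x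
  have hcoef : ∀ n, fourierCoeff G n = coeff F n z.im := by
    intro n
    rw [fourierCoeff_eq_intervalIntegral _ _ 0]
    simp only [one_div, inv_one, one_smul, zero_add, coeff]
    refine intervalIntegral.integral_congr fun x _ => ?_
    simp only [hG, smul_eq_mul, fourier_coe_apply, g]
    congr 2; push_cast; ring
  have := has_pointwise_sum_fourier_series_of_summable (f := G)
    (by simpa only [funext hcoef] using hs) (z.re : UnitAddCircle)
  rw [hG] at this
  convert this using 1
  · ext n
    rw [hcoef, smul_eq_mul, fourier_coe_apply]
    simp
  · simp only [g, Function.comp]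
    rw [show (z.re : ℂ) + z.im * Complex.I = z from Complex.re_add_im z, ofComplex_apply]

/-! ### The differential equation of the Fourier coefficients -/

lemma eq_of_hasDerivAt_zero_Ioi {g : ℝ → ℂ} (h : ∀ y : ℝ, 0 < y → HasDerivAt g 0 y) :
    ∀ y : ℝ, 0 < y → g y = g 1 := fun _ hy =>
  isOpen_Ioi.is_const_of_deriv_eq_zero isPreconnected_Ioi (s := Ioi (0 : ℝ))
    (fun x hx => (h x hx).differentiableAt.differentiableWithinAt)
    (fun x hx => (h x hx).deriv) hy (mem_Ioi.2 one_pos)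

/-- Solutions of `w'' = κ w'` are spanned by `1` and any solution with `r' ≠ 0`. -/
lemma exists_eq_add_mul_of_linear_ode {w w₁ r r₁ κ : ℝ → ℂ}
    (hw : ∀ y : ℝ, 0 < y → HasDerivAt w (w₁ y) y) (hw₁ : ∀ y : ℝ, 0 < y → HasDerivAt w₁ (κ y * w₁ y) y)
    (hr : ∀ y : ℝ, 0 < y → HasDerivAt r (r₁ y) y) (hr₁ : ∀ y : ℝ, 0 < y → HasDerivAt r₁ (κ y * r₁ y) y)
    (hne : ∀ y : ℝ, 0 < y → r₁ y ≠ 0) : ∃ c b : ℂ, ∀ y : ℝ, 0 < y → w y = c + b * r y := by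
  -- Both derivatives solve the same first-order linear equation, so their quotient is constant.
  have h1 := eq_of_hasDerivAt_zero_Ioi (g := fun y => w₁ y / r₁ y) fun y hy => by
    refine ((hw₁ y hy).fun_div (hr₁ y hy) (hne y hy)).congr_deriv ?_
    rw [div_eq_zero_iff]; left; ring
  set b := w₁ 1 / r₁ 1
  have h2 := eq_of_hasDerivAt_zero_Ioi (g := fun y => w y - b * r y) fun y hy => by
    refine ((hw y hy).fun_sub ((hr y hy).const_mul b)).congr_deriv ?_
    rw [← h1 y hy, div_mul_cancel₀ _ (hne y hy), sub_self]
  exact ⟨w 1 - b * r 1, b, fun y hy => by rw [← h2 y hy]; ring⟩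

lemma hasDerivAt_exp_real (m : ℂ) (y : ℝ) :
    HasDerivAt (fun y : ℝ => Complex.exp (m * y)) (m * Complex.exp (m * y)) y := by
  have : HasDerivAt (fun y : ℝ => m * (y : ℂ)) m y := by
    simpa using (Complex.ofRealCLM.hasDerivAt (x := y)).const_mul m
  simpa [mul_comm] using this.cexp

/-- The Fourier coefficients of a solution of the Cauchy-Riemann equations. -/
lemma coeff_eq_of_cauchyRiemann {f : ℍ → ℂ} (hf : RealAnalytic f) (hp : OnePeriodic f)
    (h : ∀ z, dx f z + Complex.I * dy f z = 0) (n : ℤ) :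
    ∃ A : ℂ, ∀ y : ℝ, 0 < y → coeff f n y = A * Complex.exp (-(2 * Real.pi * n) * y) := by
  have hdy : dy f = fun z => Complex.I * dx f z := by
    ext z
    linear_combination (-Complex.I) * h z + dy f z * Complex.I_sq
  have hc : ∀ y : ℝ, 0 < y → coeff (dy f) n y = -(2 * Real.pi * n) * coeff f n y := by
    intro y hy
    have : coeff (dy f) n y = Complex.I * coeff (dx f) n y := by
      unfold coeff
      rw [← intervalIntegral.integral_const_mul]
      refine intervalIntegral.integral_congr fun x _ => ?_
      simp only [hdy, Function.comp]; ring
    rw [this, coeff_dx hf hp n hy]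
    linear_combination (2 * Real.pi * n * coeff f n y) * Complex.I_sq
  have h1 := eq_of_hasDerivAt_zero_Ioi
    (g := fun y => coeff f n y * Complex.exp ((2 * Real.pi * n) * y)) fun y hy => by
    refine ((hasDerivAt_coeff hf n hy).fun_mul (hasDerivAt_exp_real _ y)).congr_deriv ?_
    rw [hc y hy]; ring
  refine ⟨coeff f n 1 * Complex.exp ((2 * Real.pi * n) * (1 : ℝ)), fun y hy => ?_⟩
  rw [← h1 y hy, mul_assoc, ← Complex.exp_add]
  simp

lemma OnePeriodic.laplacian {F : ℍ → ℂ} (hF : OnePeriodic F) (k : ℝ) :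
    OnePeriodic (laplacian k F) := by
  intro z
  simp only [Sesqui.laplacian, hF.dx.dx z, hF.dx z, hF.dy.dy z, hF.dy z, vadd_im]

/-- The Fourier coefficient of `F`, up to the factor `exp (-2 π n y)`, is a particular solution
`p` of the differential equation plus a combination of `1` and `r`. -/
lemma exists_coeff_eq {F : ℍ → ℂ} (hF : RealAnalytic F) (hp : OnePeriodic F) (n : ℤ) (A : ℂ)
    (hA : ∀ y : ℝ, 0 < y → coeff (laplacian (1 / 2) F) n y = A * Complex.exp (-(2 * Real.pi * n) * y))
    {p p₁ r r₁ : ℝ → ℂ} (hp₀ : ∀ y : ℝ, 0 < y → HasDerivAt p (p₁ y) y)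
    (hp₁ : ∀ y : ℝ, 0 < y → HasDerivAt p₁
      ((4 * Real.pi * n - 1 / (2 * y) : ℂ) * p₁ y - A / (y : ℂ) ^ 2) y)
    (hr : ∀ y : ℝ, 0 < y → HasDerivAt r (r₁ y) y)
    (hr₁ : ∀ y : ℝ, 0 < y → HasDerivAt r₁ ((4 * Real.pi * n - 1 / (2 * y) : ℂ) * r₁ y) y)
    (hne : ∀ y : ℝ, 0 < y → r₁ y ≠ 0) :
    ∃ c b : ℂ, ∀ y : ℝ, 0 < y → coeff F n y * Complex.exp (2 * Real.pi * n * y) = c + b * r y + p y := by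
  set m : ℂ := 2 * Real.pi * n
  have hg : ∀ y : ℝ, 0 < y → HasDerivAt (fun y => coeff F n y * Complex.exp (m * y))
      ((coeff (dy F) n y + m * coeff F n y) * Complex.exp (m * y)) y := fun y hy =>
    ((hasDerivAt_coeff hF n hy).fun_mul (hasDerivAt_exp_real m y)).congr_deriv (by ring)
  -- Multiplying by `e^{2πny}` removes the zeroth-order term, because `q^n` is holomorphic and so
  -- annihilated by the Laplacian. What remains is first order in `w'`.
  have hg₁ : ∀ y : ℝ, 0 < y → HasDerivAt
      (fun y => (coeff (dy F) n y + m * coeff F n y) * Complex.exp (m * y))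
      ((4 * Real.pi * n - 1 / (2 * y) : ℂ) *
        ((coeff (dy F) n y + m * coeff F n y) * Complex.exp (m * y)) - A / (y : ℂ) ^ 2) y := by
    intro y hy
    refine (((hasDerivAt_coeff hF.dy n hy).fun_add
      ((hasDerivAt_coeff hF n hy).const_mul m)).fun_mul (hasDerivAt_exp_real m y)).congr_deriv ?_
    have e := hA y hy
    rw [coeff_laplacian hF _ n hy, coeff_dx hF.dx hp.dx n hy, coeff_dx hF hp n hy] at e
    have hy' : (y : ℂ) ≠ 0 := by exact_mod_cast hy.ne'
    have e1 : Complex.exp (-m * y) * Complex.exp (m * y) = 1 := by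
      rw [← Complex.exp_add]; simp
    have hm : 2 * Real.pi * Complex.I * n = m * Complex.I := by simp only [m]; ring
    have hm' : 4 * Real.pi * n = 2 * m := by simp only [m]; ring
    rw [hm] at e
    rw [hm']
    push_cast at e
    generalize coeff F n y = c0 at *
    generalize coeff (dy F) n y = c1 at *
    generalize coeff (dy (dy F)) n y = c2 at *
    field_simp
    linear_combination (-2 * Complex.exp (m * y)) * e - 2 * A * e1 +
      (Complex.exp (m * y) * (-2 * y ^ 2 * m ^ 2 * c0 + y * m * c0 + y * c1)) * Complex.I_sq
  obtain ⟨c, b, h⟩ := exists_eq_add_mul_of_linear_ode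
    (w := fun y => coeff F n y * Complex.exp (m * y) - p y)
    (κ := fun y => (4 * Real.pi * n - 1 / (2 * y) : ℂ))
    (fun y hy => (hg y hy).fun_sub (hp₀ y hy))
    (fun y hy => ((hg₁ y hy).fun_sub (hp₁ y hy)).congr_deriv (by ring)) hr hr₁ hne
  exact ⟨c, b, fun y hy => by rw [← h y hy]; ring⟩

lemma hasDerivAt_rpow_ofReal {y : ℝ} (hy : 0 < y) (e : ℝ) :
    HasDerivAt (fun y : ℝ => ((y ^ e : ℝ) : ℂ)) ((e : ℂ) / y * ((y ^ e : ℝ) : ℂ)) y := by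
  refine ((Real.hasDerivAt_rpow_const (p := e) (Or.inl hy.ne')).ofReal_comp).congr_deriv ?_
  rw [Real.rpow_sub_one hy.ne']
  push_cast; ring

/-- With `n = 0` the equation is `w'' = -w'/(2y) - A/y²`, solved by `1`, `√y` and the particular
solution `2A log y`; no `√y log y` arises. -/
lemma exists_coeff_zero_eq {F : ℍ → ℂ} (hF : RealAnalytic F) (hp : OnePeriodic F) (A : ℂ)
    (hA : ∀ y : ℝ, 0 < y → coeff (laplacian (1 / 2) F) 0 y
      = A * Complex.exp (-(2 * Real.pi * (0 : ℤ)) * y)) :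
    ∃ c b : ℂ, ∀ y : ℝ, 0 < y → coeff F 0 y =
      c + 2 * A * (Real.log y : ℂ) + b * ((y ^ (1 / 2 : ℝ) : ℝ) : ℂ) := by
  have hne : ∀ y : ℝ, 0 < y → (y : ℂ) ≠ 0 := fun y hy => by exact_mod_cast hy.ne'
  have hinv : ∀ y : ℝ, 0 < y → HasDerivAt (fun y : ℝ => (y : ℂ)⁻¹) (-1 / (y : ℂ) ^ 2) y :=
    fun y hy => (Complex.ofRealCLM.hasDerivAt (x := y)).fun_inv (hne y hy) |>.congr_deriv (by simp)
  obtain ⟨c, b, h⟩ := exists_coeff_eq hF hp 0 A hA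
    (p := fun y => 2 * A * (Real.log y : ℂ)) (p₁ := fun y => 2 * A * (y : ℂ)⁻¹)
    (r := fun y => ((y ^ (1 / 2 : ℝ) : ℝ) : ℂ))
    (r₁ := fun y => (((1 / 2 : ℝ) : ℂ)) * (y : ℂ)⁻¹ * ((y ^ (1 / 2 : ℝ) : ℝ) : ℂ))
    (fun y hy => (((Real.hasDerivAt_log hy.ne').ofReal_comp).const_mul _).congr_deriv (by push_cast; rfl))
    (fun y hy => ((hinv y hy).const_mul _).congr_deriv (by
      have := hne y hy
      push_cast; field_simp; ring))
    (fun y hy => (hasDerivAt_rpow_ofReal hy _).congr_deriv (by rw [div_eq_mul_inv]))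
    (fun y hy => (((hinv y hy).const_mul _).fun_mul (hasDerivAt_rpow_ofReal hy _)).congr_deriv (by
      have := hne y hy
      push_cast; field_simp; ring))
    (fun y hy => by
      have := hne y hy
      have h2 : ((y ^ (1 / 2 : ℝ) : ℝ) : ℂ) ≠ 0 := by
        exact_mod_cast (Real.rpow_pos_of_pos hy _).ne'
      refine mul_ne_zero (mul_ne_zero ?_ (inv_ne_zero this)) h2
      norm_num)
  refine ⟨c, b, fun y hy => ?_⟩
  have := h y hy
  simp only [Int.cast_zero, mul_zero, zero_mul, Complex.exp_zero, mul_one] at this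
  rw [this]; ring

/-- `y ↦ beta (-4 n y)` solves the homogeneous equation. -/
lemma exists_hasDerivAt_beta_comp {n : ℤ} (hn : n ≠ 0) : ∃ r₁ : ℝ → ℂ,
    (∀ y : ℝ, 0 < y → HasDerivAt (fun y : ℝ => beta (-4 * n * y)) (r₁ y) y) ∧
    (∀ y : ℝ, 0 < y → HasDerivAt r₁ ((4 * Real.pi * n - 1 / (2 * y) : ℂ) * r₁ y) y) ∧
    ∀ y : ℝ, 0 < y → r₁ y ≠ 0 := by
  have hn' : (n : ℝ) ≠ 0 := by exact_mod_cast hn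
  have hlin : ∀ y : ℝ, HasDerivAt (fun y : ℝ => -4 * (n : ℝ) * y) (-4 * n) y := fun y => by
    simpa using (hasDerivAt_id y).const_mul (-4 * (n : ℝ))
  -- Both signs of `n` give `y^{-1/2} e^{4πny}`; the branch affects only the nonzero constant.
  obtain ⟨C, hC, hb⟩ : ∃ C : ℂ, C ≠ 0 ∧ ∀ y : ℝ, 0 < y → betaDeriv (-4 * n * y) =
      C * ((y ^ (-(1 / 2) : ℝ) : ℝ) : ℂ) * Complex.exp (4 * Real.pi * n * y) := by
    rcases lt_or_gt_of_ne hn' with h | h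
    · have h4 : 0 < -4 * (n : ℝ) := by linarith
      refine ⟨-(((-4 * n : ℝ) ^ (-(1 / 2) : ℝ) : ℝ) : ℂ), ?_, fun y hy => ?_⟩
      · exact neg_ne_zero.2 (by exact_mod_cast (Real.rpow_pos_of_pos h4 _).ne')
      · rw [betaDeriv_pos (mul_pos h4 hy), Real.mul_rpow h4.le hy.le]
        rw [show -(Real.pi * (-4 * (n : ℝ) * y)) = 4 * Real.pi * n * y by ring]
        push_cast; ring
    · have h4 : 0 < 4 * (n : ℝ) := by linarith
      refine ⟨Complex.I * (((4 * n : ℝ) ^ (-(1 / 2) : ℝ) : ℝ) : ℂ), ?_, fun y hy => ?_⟩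
      · exact mul_ne_zero Complex.I_ne_zero (by exact_mod_cast (Real.rpow_pos_of_pos h4 _).ne')
      · rw [show -4 * (n : ℝ) * y = -(4 * n * y) by ring, betaDeriv_neg (mul_pos h4 hy),
          Real.mul_rpow h4.le hy.le, show Real.pi * (4 * (n : ℝ) * y) = 4 * Real.pi * n * y by ring]
        push_cast; ring
  refine ⟨fun y => (-4 * n : ℂ) * (C * ((y ^ (-(1 / 2) : ℝ) : ℝ) : ℂ) *
    Complex.exp (4 * Real.pi * n * y)), fun y hy => ?_, fun y hy => ?_, fun y hy => ?_⟩
  · have h0 : -4 * (n : ℝ) * y ≠ 0 := by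
      have := hy.ne'
      positivity
    refine ((hasDerivAt_beta h0).scomp y (hlin y)).congr_deriv ?_
    rw [hb y hy, Complex.real_smul]; push_cast; ring
  · refine ((((hasDerivAt_rpow_ofReal hy _).const_mul C).fun_mul
      (hasDerivAt_exp_real (4 * Real.pi * n) y)).const_mul _).congr_deriv ?_
    have hy' : (y : ℂ) ≠ 0 := by exact_mod_cast hy.ne'
    push_cast; field_simp; ring
  · have h2 : ((y ^ (-(1 / 2) : ℝ) : ℝ) : ℂ) ≠ 0 := by
      exact_mod_cast (Real.rpow_pos_of_pos hy _).ne'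
    have h3 : (n : ℂ) ≠ 0 := by exact_mod_cast hn
    exact mul_ne_zero (mul_ne_zero (by norm_num) h3) (mul_ne_zero (mul_ne_zero hC h2)
      (Complex.exp_ne_zero _))

/-- The factor `-8πA` turns the inhomogeneity `1/(8πy²)` of the equation for `α(4ny)` into `-A/y²`.
For `n < 0` the term vanishes with `A`, so values of `alpha` at negative arguments play no role. -/
lemma exists_coeff_ne_zero_eq {F : ℍ → ℂ} (hF : RealAnalytic F) (hp : OnePeriodic F) {n : ℤ}
    (hn : n ≠ 0) (A : ℂ) (hA0 : n < 0 → A = 0)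
    (hA : ∀ y : ℝ, 0 < y → coeff (laplacian (1 / 2) F) n y = A * Complex.exp (-(2 * Real.pi * n) * y)) :
    ∃ c b : ℂ, ∀ y : ℝ, 0 < y → coeff F n y * Complex.exp (2 * Real.pi * n * y) =
      c + b * beta (-4 * n * y) + (-8 * Real.pi * A) * (alpha (4 * n * y) : ℂ) := by
  obtain ⟨r₁, hr, hr₁, hne⟩ := exists_hasDerivAt_beta_comp hn
  rcases lt_or_gt_of_ne hn with h | h
  · obtain rfl := hA0 h
    simpa using exists_coeff_eq hF hp n 0 hA (p := fun _ => 0) (p₁ := fun _ => 0)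
      (fun y _ => hasDerivAt_const y 0)
      (fun y _ => (hasDerivAt_const y (0 : ℂ)).congr_deriv (by simp)) hr hr₁ hne
  · have h4 : 0 < 4 * (n : ℝ) := by
      have : (0 : ℝ) < n := by exact_mod_cast h
      linarith
    have hlin : ∀ y : ℝ, HasDerivAt (fun y : ℝ => 4 * (n : ℝ) * y) (4 * n) y := fun y => by
      simpa using (hasDerivAt_id y).const_mul (4 * (n : ℝ))
    refine exists_coeff_eq hF hp n A hA
      (p₁ := fun y => (-8 * Real.pi * A) * (alphaDeriv (4 * n * y) * (4 * n) : ℝ)) (fun y hy => ?_)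
      (fun y hy => ?_) hr hr₁ hne
    · exact (((hasDerivAt_alpha (mul_pos h4 hy)).comp y (hlin y)).ofReal_comp).const_mul _
    · refine (((((hasDerivAt_alphaDeriv (mul_pos h4 hy)).comp y (hlin y)).mul_const
        (4 * (n : ℝ))).ofReal_comp).const_mul _).congr_deriv ?_
      unfold alphaDeriv₂
      have hy' : (y : ℂ) ≠ 0 := by exact_mod_cast hy.ne'
      have hn' : (n : ℂ) ≠ 0 := by exact_mod_cast hn
      have hpi : (Real.pi : ℂ) ≠ 0 := by exact_mod_cast Real.pi_pos.ne'
      push_cast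
      field_simp
      ring

/-! ### Consequences of modularity and growth -/

/-- The translation `T` lies in every `Γ₀(4N)`, with automorphy factor and multiplier both `1`. -/
lemma TransformsHalf.onePeriodic {N : ℕ} {F : ℍ → ℂ} (hF : TransformsHalf N F) :
    OnePeriodic F := by
  intro z
  have hT : ModularGroup.T ∈ CongruenceSubgroup.Gamma0 (4 * N) := by
    simp [CongruenceSubgroup.Gamma0_mem, ModularGroup.coe_T]
  have := hF _ hT z
  rw [slash, UpperHalfPlane.modular_T_smul] at this
  simpa [slash, ModularGroup.coe_T, thetaMultiplier, epsilon, kroneckerOdd] using this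

lemma slash_one (k : ℝ) (F : ℍ → ℂ) : slash k F 1 = F := by
  ext z; simp [slash]

lemma LinearExponentialGrowthAtCusps.exists_bound {F : ℍ → ℂ}
    (h : LinearExponentialGrowthAtCusps F) :
    ∃ C ≥ 0, ∃ K Y : ℝ, ∀ z : ℍ, Y ≤ z.im → ‖F z‖ ≤ K * Real.exp (C * z.im) := by
  obtain ⟨C, hC⟩ := h 1
  rw [slash_one] at hC
  obtain ⟨K, hK, hb⟩ := hC.exists_pos
  obtain ⟨Y, hY⟩ := (atImInfty_mem _).1 hb.bound
  refine ⟨max C 0, le_max_right _ _, K, Y, fun z hz => (hY z hz).trans ?_⟩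
  rw [Real.norm_of_nonneg (Real.exp_pos _).le]
  have := z.im_pos
  gcongr
  exact le_max_left _ _

lemma norm_coeff_le_of_norm_le {F : ℍ → ℂ} (n : ℤ) {y M : ℝ} (hy : 0 < y)
    (h : ∀ z : ℍ, z.im = y → ‖F z‖ ≤ M) : ‖coeff F n y‖ ≤ M :=
  norm_coeff_le n fun x => h _ (by
    rw [← coe_im, coe_ofComplex (im_add_mul_I_pos hy)]; simp)

/-- For `n < 0` the factor `e^{-2πny}` is unbounded as `y → ∞`, while the coefficient is bounded by
the supremum of `f`. -/
lemma eq_zero_of_bounded_of_neg {f : ℍ → ℂ} (hf : IsBoundedAtImInfty f) {n : ℤ} (hn : n < 0)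
    {A : ℂ} (hA : ∀ y : ℝ, 0 < y → coeff f n y = A * Complex.exp (-(2 * Real.pi * n) * y)) :
    A = 0 := by
  obtain ⟨M, Y, hM⟩ := isBoundedAtImInfty_iff.1 hf
  have hn' : (n : ℝ) < 0 := by exact_mod_cast hn
  have hc : 2 * Real.pi * (n : ℝ) < 0 := mul_neg_of_pos_of_neg Real.two_pi_pos hn'
  have hlim : Tendsto (fun y : ℝ => M * Real.exp (2 * Real.pi * n * y)) atTop (𝓝 0) := by
    rw [← mul_zero M]
    exact (Real.tendsto_exp_atBot.comp (tendsto_id.const_mul_atTop_of_neg hc)).const_mul M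
  refine norm_le_zero_iff.1 (ge_of_tendsto hlim ?_)
  filter_upwards [eventually_ge_atTop Y, eventually_gt_atTop 0] with y hy hy0
  have h1 : ‖coeff f n y‖ ≤ M := norm_coeff_le_of_norm_le n hy0 fun z hz => hM z (hz ▸ hy)
  rw [hA y hy0, norm_mul, Complex.norm_exp] at h1
  have h2 : (-(2 * Real.pi * n) * y : ℂ).re = -(2 * Real.pi * n * y) := by
    rw [show (-(2 * Real.pi * n) * y : ℂ) = ((-(2 * Real.pi * n * y) : ℝ) : ℂ) by push_cast; ring,
      Complex.ofReal_re]
  rw [h2, Real.exp_neg, ← div_eq_mul_inv, div_le_iff₀ (Real.exp_pos _)] at h1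
  exact h1

lemma norm_exp_two_pi_mul (n : ℤ) (y : ℝ) :
    ‖Complex.exp (2 * Real.pi * n * y)‖ = Real.exp (2 * Real.pi * n * y) := by
  rw [Complex.norm_exp, show (2 * Real.pi * n * y : ℂ) = ((2 * Real.pi * n * y : ℝ) : ℂ) by
    push_cast; ring, Complex.ofReal_re]

lemma norm_qpow (n : ℤ) (z : ℍ) : ‖qpow n z‖ = Real.exp (-(2 * Real.pi * n * z.im)) := by
  rw [qpow, Complex.norm_exp]
  congr 1
  simp [Complex.mul_re, Complex.mul_im]

/-- A holomorphic part of very negative index would violate the growth condition. -/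
lemma eq_zero_of_growth_neg {g : ℝ → ℂ} {n : ℤ} {c b : ℂ} {C K Y : ℝ} (hn : n < 0)
    (hC : C + 2 * Real.pi * n < 0)
    (hg : ∀ y : ℝ, 0 < y → Y ≤ y → ‖g y‖ ≤ K * Real.exp (C * y))
    (h : ∀ y : ℝ, 0 < y → g y * Complex.exp (2 * Real.pi * n * y) = c + b * beta (-4 * n * y)) :
    c = 0 := by
  have hn' : (n : ℝ) < 0 := by exact_mod_cast hn
  have h1 : Tendsto (fun y : ℝ => g y * Complex.exp (2 * Real.pi * n * y)) atTop (𝓝 0) := by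
    have hlim : Tendsto (fun y : ℝ => K * Real.exp ((C + 2 * Real.pi * n) * y)) atTop (𝓝 0) := by
      rw [← mul_zero K]
      exact (Real.tendsto_exp_atBot.comp (tendsto_id.const_mul_atTop_of_neg hC)).const_mul K
    refine squeeze_zero_norm' ?_ hlim
    filter_upwards [eventually_ge_atTop Y, eventually_gt_atTop 0] with y hy hy0
    rw [norm_mul, norm_exp_two_pi_mul, add_mul, Real.exp_add, ← mul_assoc]
    have := hg y hy0 hy
    gcongr
  have h2 : Tendsto (fun y : ℝ => c + b * beta (-4 * n * y)) atTop (𝓝 (c + b * 0)) := by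
    refine ((tendsto_beta_atTop.comp ?_).const_mul b).const_add c
    exact tendsto_id.const_mul_atTop (by linarith : 0 < -4 * (n : ℝ))
  have h3 := tendsto_nhds_unique (h1.congr' (by
    filter_upwards [eventually_gt_atTop 0] with y hy0 using h y hy0)) h2
  simpa using h3.symm

/-- A nonholomorphic part of very positive index would violate the growth condition. -/
lemma eq_zero_of_growth_pos {g : ℝ → ℂ} {n : ℤ} {c b a : ℂ} {C K Y : ℝ} (hn : 0 < n) (hC₀ : 0 ≤ C)
    (hC : C < 2 * Real.pi * n)
    (hg : ∀ y : ℝ, 0 < y → Y ≤ y → ‖g y‖ ≤ K * Real.exp (C * y))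
    (h : ∀ y : ℝ, 0 < y → g y * Complex.exp (2 * Real.pi * n * y) =
      c + b * beta (-4 * n * y) + a * (alpha (4 * n * y) : ℂ)) :
    b = 0 := by
  have hn' : (0 : ℝ) < n := by exact_mod_cast hn
  have hp := Real.pi_pos
  -- In the variable `s = 4ny` the left side of `h` is `O(e^{rs})`. The condition `C < 2πn` says
  -- precisely that `r < π`.
  set r : ℝ := (C + 2 * Real.pi * n) / (4 * n)
  have hr0 : 0 ≤ r := by positivity
  refine eq_zero_of_beta_neg_le (M := K + ‖c‖ + ‖a‖) (r := r)
    (s₀ := max 1 (4 * n * Y)) ?_ fun s hs => ?_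
  · rw [div_lt_iff₀ (by positivity)]; linarith
  · have hs1 : 1 ≤ s := (le_max_left _ _).trans hs
    have hs2 : 4 * n * Y ≤ s := (le_max_right _ _).trans hs
    set y := s / (4 * n)
    have hy0 : 0 < y := by positivity
    have hsy : 4 * (n : ℝ) * y = s := by simp only [y]; field_simp
    have hyY : Y ≤ y := by rw [le_div_iff₀ (by positivity)]; linarith
    have hry : (C + 2 * Real.pi * n) * y = r * s := by simp only [y, r]; field_simp
    have h1 : b * beta (-s) = g y * Complex.exp (2 * Real.pi * n * y) - c - a * (alpha s : ℂ) := by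
      rw [h y hy0, hsy, show -4 * (n : ℝ) * y = -s by rw [← hsy]; ring]; ring
    have hg1 : ‖g y * Complex.exp (2 * Real.pi * n * y)‖ ≤ K * Real.exp (r * s) := by
      rw [norm_mul, norm_exp_two_pi_mul, ← hry, add_mul, Real.exp_add, ← mul_assoc]
      have := hg y hy0 hyY
      gcongr
    have ha : ‖(alpha s : ℂ)‖ ≤ 1 := by
      rw [Complex.norm_real, Real.norm_of_nonneg (alpha_nonneg s)]
      refine (alpha_le (by linarith)).trans ?_
      rw [div_le_one (by linarith)]; exact hs1
    have he : 1 ≤ Real.exp (r * s) := Real.one_le_exp (by positivity)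
    rw [h1]
    calc _ ≤ ‖g y * Complex.exp (2 * Real.pi * n * y)‖ + ‖c‖ + ‖a * (alpha s : ℂ)‖ :=
          (norm_sub_le _ _).trans (by gcongr; exact norm_sub_le _ _)
      _ ≤ K * Real.exp (r * s) + ‖c‖ * 1 + ‖a‖ * 1 := by
          have := mul_le_mul_of_nonneg_left ha (norm_nonneg a)
          rw [norm_mul a]
          linarith
      _ ≤ K * Real.exp (r * s) + ‖c‖ * Real.exp (r * s) + ‖a‖ * Real.exp (r * s) := by gcongr
      _ = _ := by ring

/-! ### Convergence -/

lemma summable_exp_neg_mul_abs {r : ℝ} (hr : 0 < r) :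
    Summable (fun n : ℤ => Real.exp (-(r * |(n : ℝ)|))) := by
  have h : Summable (fun n : ℕ => Real.exp (n * (-r))) := Real.summable_exp_nat_mul_iff.2 (by linarith)
  refine Summable.of_nat_of_neg ?_ ?_ <;>
  · refine h.congr fun n => ?_
    congr 1; simp; ring

lemma summable_of_norm_le_exp {f : ℤ → ℂ} {r K : ℝ} (hr : 0 < r)
    (h : ∀ᶠ n in cofinite, ‖f n‖ ≤ K * Real.exp (-(r * |(n : ℝ)|))) : Summable f :=
  Summable.of_norm_bounded_eventually ((summable_exp_neg_mul_abs hr).mul_left K) h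

lemma eventually_cofinite_of_lt_of_gt {p : ℤ → Prop} (l u : ℤ) (hl : ∀ n < l, p n)
    (hu : ∀ n > u, p n) : ∀ᶠ n in cofinite, p n := by
  refine (finite_Icc l u).subset fun n hn => ?_
  by_contra hc
  rw [mem_Icc, not_and_or, not_le, not_le] at hc
  exact hn (hc.elim (hl n) (hu n))

/-- The hypothesis is what a bound at height `y/2` yields: it costs `e^{πny}` out of the `e^{-2πny}`
supplied by `q^n`. -/
lemma norm_mul_alpha_mul_qpow_le {A : ℂ} {n : ℤ} (hn : 0 < n) (z : ℍ) {M : ℝ}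
    (hA : ‖A‖ ≤ M * Real.exp (2 * Real.pi * n * (z.im / 2))) :
    ‖A * (alpha (4 * n * z.im) : ℂ) * qpow n z‖ ≤
      M * (1 / z.im) * Real.exp (-(Real.pi * z.im * |(n : ℝ)|)) := by
  have hn' : (1 : ℝ) ≤ n := by exact_mod_cast hn
  have hy := z.im_pos
  have ha : alpha (4 * n * z.im) ≤ 1 / z.im := by
    refine (alpha_le (by positivity)).trans (one_div_le_one_div_of_le hy ?_)
    nlinarith
  rw [norm_mul, norm_mul, Complex.norm_real, Real.norm_of_nonneg (alpha_nonneg _), norm_qpow,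
    abs_of_pos (by linarith)]
  have := alpha_nonneg (4 * n * z.im)
  calc _ ≤ M * Real.exp (2 * Real.pi * n * (z.im / 2)) * (1 / z.im) *
        Real.exp (-(2 * Real.pi * n * z.im)) := by
        have := (norm_nonneg A).trans hA
        gcongr
    _ = M * (1 / z.im) * (Real.exp (2 * Real.pi * n * (z.im / 2)) *
        Real.exp (-(2 * Real.pi * n * z.im))) := by ring
    _ = _ := by rw [← Real.exp_add]; congr 2; ring

lemma norm_mul_qpow_le {c : ℂ} {n : ℤ} (hn : 0 < n) (z : ℍ) {M : ℝ}
    (hc : ‖c‖ ≤ M * Real.exp (2 * Real.pi * n * (z.im / 2))) :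
    ‖c * qpow n z‖ ≤ M * Real.exp (-(Real.pi * z.im * |(n : ℝ)|)) := by
  have hn' : (0 : ℝ) < n := by exact_mod_cast hn
  rw [norm_mul, norm_qpow, abs_of_pos hn']
  calc _ ≤ M * Real.exp (2 * Real.pi * n * (z.im / 2)) *
        Real.exp (-(2 * Real.pi * n * z.im)) := by gcongr
    _ = _ := by rw [mul_assoc, ← Real.exp_add]; congr 2; ring

/-- Doubling the argument of `beta` gains `e^{-2πy|n|}`, which cancels the growth of `q^n`; the
hypothesis supplies the remaining `e^{-πy|n|}`. -/
lemma norm_mul_beta_mul_qpow_le {b : ℂ} {n : ℤ} (hn : n < 0) (z : ℍ) {M : ℝ}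
    (hb : ‖b * beta (-4 * n * (z.im / 2))‖ ≤ M * Real.exp (2 * Real.pi * n * (z.im / 2))) :
    ‖b * beta (-4 * n * z.im) * qpow n z‖ ≤ M * Real.exp (-(Real.pi * z.im * |(n : ℝ)|)) := by
  have hn' : (n : ℝ) < 0 := by exact_mod_cast hn
  have hy := z.im_pos
  have hpos : 0 < -4 * (n : ℝ) * (z.im / 2) := mul_pos (by linarith) (by linarith)
  have h := norm_beta_add_le hpos hpos.le
  rw [show -4 * (n : ℝ) * (z.im / 2) + -4 * (n : ℝ) * (z.im / 2) = -4 * n * z.im by ring] at h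
  rw [norm_mul, norm_mul, norm_qpow, abs_of_neg hn']
  rw [norm_mul] at hb
  calc _ ≤ ‖b‖ * (Real.exp (-(Real.pi * (-4 * n * (z.im / 2)))) * ‖beta (-4 * n * (z.im / 2))‖) *
        Real.exp (-(2 * Real.pi * n * z.im)) := by gcongr
    _ = (‖b‖ * ‖beta (-4 * n * (z.im / 2))‖) * (Real.exp (-(Real.pi * (-4 * n * (z.im / 2)))) *
        Real.exp (-(2 * Real.pi * n * z.im))) := by ring
    _ ≤ (M * Real.exp (2 * Real.pi * n * (z.im / 2))) *
        (Real.exp (-(Real.pi * (-4 * n * (z.im / 2)))) *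
        Real.exp (-(2 * Real.pi * n * z.im))) := by gcongr
    _ = _ := by
      rw [← Real.exp_add, mul_assoc, ← Real.exp_add]; congr 2; ring

lemma coeff_mul_exp_eq (F : ℍ → ℂ) (n : ℤ) (z : ℍ) {S : ℂ}
    (h : coeff F n z.im * Complex.exp (2 * Real.pi * n * z.im) = S) :
    coeff F n z.im * Complex.exp (2 * Real.pi * Complex.I * n * z.re) = S * qpow n z := by
  rw [← h, qpow, mul_assoc (coeff F n z.im), ← Complex.exp_add]
  congr 2
  have e : (z : ℂ) = z.re + z.im * Complex.I := (Complex.re_add_im (z : ℂ)).symm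
  linear_combination (-(2 * Real.pi * n * z.im)) * Complex.I_sq - 2 * Real.pi * Complex.I * n * e

end Sesqui

end

/-! ### Assembling the expansion. -/

theorem mainTheorem6 (N : ℕ) (hN : 1 ≤ N) (F : UpperHalfPlane → ℂ)
    (hF : F ∈ Sesqui.sesquiharmonicSpaceHalf N) :
    ∃ (d : Fin 4 → ℂ) (c b : ℤ → ℂ) (a : ℕ+ → ℂ),
      (c 0 = 0 ∧ ∃ m : ℤ, ∀ n < m, c n = 0) ∧
      (b 0 = 0 ∧ ∃ m : ℤ, ∀ n > m, b n = 0) ∧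
      ∀ z : UpperHalfPlane,
        Summable (fun n : ℤ => c n * Sesqui.qpow n z) ∧
        Summable (fun n : ℤ => b n * Sesqui.beta (-4 * n * z.im) * Sesqui.qpow n z) ∧
        Summable (fun n : ℕ+ => a n * (Sesqui.alpha (4 * n * z.im) : ℂ) * Sesqui.qpow n z) ∧
        F z =
          (d 0 + d 1 * (Real.log z.im : ℂ) + d 2 * ((z.im ^ (1 / 2 : ℝ) : ℝ) : ℂ)
            + d 3 * ((z.im ^ (1 / 2 : ℝ) : ℝ) : ℂ) * (Real.log z.im : ℂ))
          + ∑' n : ℤ, c n * Sesqui.qpow n z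
          + ∑' n : ℤ, b n * Sesqui.beta (-4 * n * z.im) * Sesqui.qpow n z
          + ∑' n : ℕ+, a n * (Sesqui.alpha (4 * n * z.im) : ℂ) * Sesqui.qpow n z := by
  obtain ⟨⟨hFa, hFt, hxi, hgr⟩, -, -, hfb⟩ := hF
  have hp := hFt.onePeriodic
  have hpi := Real.pi_pos
  set f := Sesqui.laplacian (1 / 2) F with hf
  have hfa : Sesqui.RealAnalytic f := hFa.laplacian _
  have hCR : ∀ z, Sesqui.dx f z + Complex.I * Sesqui.dy f z = 0 := fun z => by
    have hy : ((z.im ^ (1 / 2 : ℝ) : ℝ) : ℂ) ≠ 0 := by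
      exact_mod_cast (Real.rpow_pos_of_pos z.im_pos _).ne'
    have h := hxi z
    rw [Sesqui.xi, mul_eq_zero, map_eq_zero] at h
    exact h.resolve_left (mul_ne_zero Complex.I_ne_zero hy)
  have hfb1 : UpperHalfPlane.IsBoundedAtImInfty f := by
    simpa only [Sesqui.slash_one] using hfb 1
  choose A hA using Sesqui.coeff_eq_of_cauchyRiemann hfa (hp.laplacian _) hCR
  have hA0 : ∀ n < 0, A n = 0 := fun n hn => Sesqui.eq_zero_of_bounded_of_neg hfb1 hn (hA n)
  obtain ⟨d0, d2, hd⟩ := Sesqui.exists_coeff_zero_eq hFa hp (A 0) (hA 0)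
  choose c b hcb using fun (n : ℤ) (hn : n ≠ 0) =>
    Sesqui.exists_coeff_ne_zero_eq hFa hp hn (A n) (hA0 n) (hA n)
  obtain ⟨C, hC0, K, Y, hK⟩ := hgr.exists_bound
  have hKc : ∀ n : ℤ, ∀ y : ℝ, 0 < y → Y ≤ y → ‖Sesqui.coeff F n y‖ ≤ K * Real.exp (C * y) :=
    fun n y hy hY => Sesqui.norm_coeff_le_of_norm_le n hy fun z hz => by
      subst hz; exact hK z hY
  obtain ⟨m, hm⟩ := exists_nat_gt C
  have hCm : ∀ x : ℝ, (m : ℝ) ≤ x → C < 2 * Real.pi * x := fun x hx => by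
    have : 0 ≤ x := (Nat.cast_nonneg m).trans hx
    nlinarith [Real.pi_gt_three]
  -- The index `0` is set to zero in all three families, its coefficient being carried by the
  -- `d(i)`.
  set c' : ℤ → ℂ := fun n => if h : n = 0 then 0 else c n h
  set b' : ℤ → ℂ := fun n => if h : n = 0 then 0 else b n h
  set a' : ℤ → ℂ := fun n => if n = 0 then 0 else -8 * Real.pi * A n
  have ha'neg : ∀ n < 0, a' n = 0 := fun n hn => by simp [a', hA0 n hn]
  have hmain : ∀ n : ℤ, n ≠ 0 → ∀ y : ℝ, 0 < y →
      Sesqui.coeff F n y * Complex.exp (2 * Real.pi * n * y) =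
      c' n + b' n * Sesqui.beta (-4 * n * y) + a' n * (Sesqui.alpha (4 * n * y) : ℂ) := by
    intro n hn y hy
    simpa [c', b', a', hn] using hcb n hn y hy
  have hc' : ∀ n : ℤ, n < -(m : ℤ) → c' n = 0 := by
    intro n hn
    have hn0 : n < 0 := by omega
    have hnr : (m : ℝ) ≤ -(n : ℝ) := by
      have : (m : ℤ) ≤ -n := by omega
      exact_mod_cast this
    refine Sesqui.eq_zero_of_growth_neg (b := b' n) hn0 (by linarith [hCm _ hnr]) (hKc n)
      fun y hy => ?_
    rw [hmain n hn0.ne y hy, ha'neg n hn0]; ring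
  have hb' : ∀ n : ℤ, n > (m : ℤ) → b' n = 0 := by
    intro n hn
    have hn0 : 0 < n := by omega
    have hnr : (m : ℝ) ≤ (n : ℝ) := by exact_mod_cast hn.le
    exact Sesqui.eq_zero_of_growth_pos hn0 hC0 (hCm _ hnr) (hKc n) (hmain n hn0.ne')
  refine ⟨![d0, 2 * A 0, d2, 0], c', b', fun n => a' n, ⟨by simp [c'], -m, hc'⟩,
    ⟨by simp [b'], m, hb'⟩, fun z => ?_⟩
  have hy := z.im_pos
  have hy2 : 0 < z.im / 2 := by positivity
  obtain ⟨M, hM⟩ := Sesqui.exists_norm_coeff_le hFa hy2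
  obtain ⟨M₁, hM₁⟩ := Sesqui.exists_norm_coeff_le hfa hy2
  have hM₁0 : 0 ≤ M₁ := (norm_nonneg _).trans (hM₁ 0)
  have hr : 0 < Real.pi * z.im := by positivity
  have ha'le : ∀ n : ℤ, ‖a' n‖ ≤ 8 * Real.pi * M₁ * Real.exp (2 * Real.pi * n * (z.im / 2)) := by
    intro n
    have e : A n = Sesqui.coeff f n (z.im / 2) *
        Complex.exp (2 * Real.pi * n * (z.im / 2 : ℝ)) := by
      rw [hA n _ hy2, mul_assoc, ← Complex.exp_add]; simp
    have h1 : ‖A n‖ ≤ M₁ * Real.exp (2 * Real.pi * n * (z.im / 2)) := by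
      rw [e, norm_mul, Sesqui.norm_exp_two_pi_mul]
      have := hM₁ n
      gcongr
    by_cases hn : n = 0
    · simp only [a', hn, if_true, norm_zero]; positivity
    · simp only [a', hn, if_false, norm_mul, norm_neg, Complex.norm_ofNat, Complex.norm_real,
        Real.norm_of_nonneg hpi.le]
      rw [mul_assoc (8 * Real.pi)]
      gcongr
  have hgle : ∀ n : ℤ, ‖Sesqui.coeff F n (z.im / 2) *
      Complex.exp (2 * Real.pi * n * (z.im / 2 : ℝ))‖ ≤
      M * Real.exp (2 * Real.pi * n * (z.im / 2)) := by
    intro n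
    rw [norm_mul, Sesqui.norm_exp_two_pi_mul]
    have := hM n
    gcongr
  have hsa : Summable (fun n : ℤ => a' n * (Sesqui.alpha (4 * n * z.im) : ℂ) * Sesqui.qpow n z) :=
    Sesqui.summable_of_norm_le_exp hr (K := 8 * Real.pi * M₁ * (1 / z.im))
      (Sesqui.eventually_cofinite_of_lt_of_gt 0 0
        (fun n hn => by
          rw [ha'neg n hn, zero_mul, zero_mul, norm_zero]; positivity)
        (fun n hn => Sesqui.norm_mul_alpha_mul_qpow_le hn z (ha'le n)))
  have hM0 : 0 ≤ M := (norm_nonneg _).trans (hM 0)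
  have hsc : Summable (fun n : ℤ => c' n * Sesqui.qpow n z) := by
    refine Sesqui.summable_of_norm_le_exp hr (K := M + 8 * Real.pi * M₁ * (1 / (z.im / 2)))
      (Sesqui.eventually_cofinite_of_lt_of_gt (-m) m
        (fun n hn => by rw [hc' n hn, zero_mul, norm_zero]; positivity) (fun n hn => ?_))
    have hn0 : 0 < n := by omega
    have hn1 : (1 : ℝ) ≤ n := by exact_mod_cast hn0
    refine Sesqui.norm_mul_qpow_le hn0 z ?_
    have h1 := hmain n hn0.ne' _ hy2
    -- With `b(n) = 0`, the constant `c(n)` is the scaled coefficient at height `y/2` minus the `α`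
    -- term, both already bounded.
    rw [hb' n hn, zero_mul, add_zero] at h1
    rw [← sub_eq_iff_eq_add.2 h1, add_mul]
    refine (norm_sub_le _ _).trans (add_le_add (hgle n) ?_)
    have h2 := Sesqui.alpha_nonneg (4 * n * (z.im / 2))
    have h3 : Sesqui.alpha (4 * n * (z.im / 2)) ≤ 1 / (z.im / 2) := by
      refine (Sesqui.alpha_le (by positivity)).trans (one_div_le_one_div_of_le hy2 ?_)
      nlinarith
    rw [norm_mul, Complex.norm_real, Real.norm_of_nonneg h2]
    calc _ ≤ 8 * Real.pi * M₁ * Real.exp (2 * Real.pi * n * (z.im / 2)) * (1 / (z.im / 2)) := by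
          have := ha'le n
          gcongr
      _ = _ := by ring
  have hsb : Summable (fun n : ℤ => b' n * Sesqui.beta (-4 * n * z.im) * Sesqui.qpow n z) := by
    refine Sesqui.summable_of_norm_le_exp hr (K := M)
      (Sesqui.eventually_cofinite_of_lt_of_gt (-m) m (fun n hn => ?_)
        (fun n hn => by rw [hb' n hn, zero_mul, zero_mul, norm_zero]; positivity))
    have hn0 : n < 0 := by omega
    refine Sesqui.norm_mul_beta_mul_qpow_le hn0 z ?_
    have h1 := hmain n hn0.ne _ hy2
    rw [hc' n hn, ha'neg n hn0, zero_mul, add_zero, zero_add] at h1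
    rw [← h1]
    exact hgle n
  set Z : ℂ := d0 + 2 * A 0 * (Real.log z.im : ℂ) + d2 * ((z.im ^ (1 / 2 : ℝ) : ℝ) : ℂ)
  have hterm : ∀ n : ℤ, Sesqui.coeff F n z.im * Complex.exp (2 * Real.pi * Complex.I * n * z.re) =
      (if n = 0 then Z else 0) + c' n * Sesqui.qpow n z
        + b' n * Sesqui.beta (-4 * n * z.im) * Sesqui.qpow n z
        + a' n * (Sesqui.alpha (4 * n * z.im) : ℂ) * Sesqui.qpow n z := by
    intro n
    by_cases hn : n = 0
    · subst hn
      simp [c', b', a', hd _ hy, Z]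
    · rw [Sesqui.coeff_mul_exp_eq F n z (hmain n hn _ hy), if_neg hn]; ring
  have hall := (((hasSum_ite_eq (0 : ℤ) Z).add hsc.hasSum).add hsb.hasSum).add hsa.hasSum
  -- Since `e^{2πinx}` has modulus one, summability of the three series passes back to the Fourier
  -- coefficients.
  have hsum : Summable (fun n : ℤ => Sesqui.coeff F n z.im) := by
    refine Summable.of_norm ((hall.summable.norm).congr fun n => ?_)
    rw [← hterm n, norm_mul, Complex.norm_exp]
    simp
  have hFz := Sesqui.hasSum_coeff hFa hp z hsum
  simp only [hterm] at hFz
  have hinj : Function.Injective (fun n : ℕ+ => (n : ℤ)) := fun p q h => by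
    simpa using h
  have hsupp : ∀ n : ℤ, n ∉ Set.range (fun n : ℕ+ => (n : ℤ)) →
      a' n * (Sesqui.alpha (4 * n * z.im) : ℂ) * Sesqui.qpow n z = 0 := by
    intro n hn
    rcases lt_trichotomy n 0 with h | h | h
    · rw [ha'neg n h]; simp
    · simp [a', h]
    · exact absurd ⟨⟨n.toNat, by omega⟩, by simp [h.le]⟩ hn
  have hsa' := (hinj.summable_iff hsupp).2 hsa
  have htsa := hinj.tsum_eq (f := fun n : ℤ =>
    a' n * (Sesqui.alpha (4 * n * z.im) : ℂ) * Sesqui.qpow n z) (fun n hn => by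
      by_contra h; exact hn (hsupp n h))
  refine ⟨hsc, hsb, by simpa [Function.comp_def] using hsa', ?_⟩
  rw [hFz.unique hall, ← htsa]
  simp [Z]
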